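/- Let $d\ge 4$ and let $(M,g)$ be a smooth $d$-dimensional Lorentzian manifold (or a domain of one) of signature $(-,+,\dots,+)$ with Levi-Civita derivative $\nabla$. Let $\mathfrak g$ be a finite-dimensional real Lie algebra with a basis for which the structure constants are $f^a{}_{bc}$, and let $A_\mu=(A^a_\mu)$ be a smooth $\mathfrak g$-valued gauge field on $M$ with field strength $$F^a_{\mu\nu}=\nabla_\mu A^a_\nu-\nabla_\nu A^a_\mu+f^a{}_{bc}A^b_\mu A^c_\nu .$$ Assume that $F$ is nonzero at every point of $M$ and solves the source-free Yang–Mills equation $\mathcal D^\mu F_{\mu\nu}=0$, where $(\mathcal D_\lambda F_{\mu\nu})^a=\nabla_\lambda F^a_{\mu\nu}+f^a{}_{bc}A^b_\lambda F^c_{\mu\nu}$. A null frame at a point is a basis $e_0=\ell$, $e_1=n$, $e_i=m_i$ ($i=2,\dots,d-1$) of the tangent space with $g(\ell,n)=1$, $g(m_i,m_j)=\delta_{ij}$ and all other products zero. Let $\ell$ be a smooth null vector field, and suppose that $F$ is null and aligned with $\ell$: at every point, in a null frame with $e_0=\ell$, the components $F^a_{0i}$, $F^a_{01}$, $F^a_{ij}$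 all vanish, so that only $\varphi'^a_i:=F^a_{1i}=F^a_{\mu\nu}n^\mu m_i^\nu$ can be nonzero. Then $\ell$ is geodetic, i.e. $\nabla_\ell\ell=c\,\ell$ for some function $c$. Moreover, at every point and for every null frame there with $e_0=\ell$, the optical matrix $\rho_{ij}=m_i^\mu m_j^\nu\nabla_\nu\ell_\mu$, with trace $\rho=\sum_i\rho_{ii}$, satisfies, for every Lie-algebra index $a$, $$\sum_j\rho_{(ij)}\,\varphi'^a_j=\frac{\rho}{2}\,\varphi'^a_i ,$$ and there are numbers $\omega^a_i$ such that $$\rho_{[ij]}=\sum_a\omega^a_{[i}\varphi'^a_{j]} .$$ In fact a single $a$ suffices: for every $a$ for which $(\varphi'^a_i)_i$ is not zero at the point, there are numbers $\omega^a_i$ with $\rho_{[ij]}=\omega^a_{[i}\varphi'^a_{j]}$ (no summation over $a$). Here $X_{(ij)}=\tfrac12(X_{ij}+X_{ji})$ and $X_{[ij]}=\tfrac12(X_{ij}-X_{ji})$. -/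

import Mathlib

open scoped Manifold ContDiff Bundle

noncomputable section

namespace NullYM

variable {d : ℕ} {M : Type*} [TopologicalSpace M] [ChartedSpace (EuclideanSpace ℝ (Fin d)) M]

/-! ### Lorentzian metrics and the Levi-Civita derivative -/

/-- A smooth Lorentzian metric of signature `(-,+,…,+)` on a `d`-dimensional smooth manifold. -/
structure LorentzianMetric (d : ℕ) (M : Type*) [TopologicalSpace M]
    [ChartedSpace (EuclideanSpace ℝ (Fin d)) M] [IsManifold (𝓡 d) ∞ M] where
  /-- The bilinear form on each tangent space. -/
  val (x : M) : TangentSpace (𝓡 d) x →L[ℝ] TangentSpace (𝓡 d) x →L[ℝ] ℝ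
  symm (x : M) (v w : TangentSpace (𝓡 d) x) : val x v w = val x w v
  signature (x : M) : ∃ e : Module.Basis (Fin d) ℝ (TangentSpace (𝓡 d) x),
    ∀ i j, val x (e i) (e j) = if i = j then (if (i : ℕ) = 0 then -1 else 1) else 0
  smooth : ContMDiff (𝓡 d)
    ((𝓡 d).prod 𝓘(ℝ, EuclideanSpace ℝ (Fin d) →L[ℝ] EuclideanSpace ℝ (Fin d) →L[ℝ] ℝ)) ∞
    (fun x => Bundle.TotalSpace.mk'
      (EuclideanSpace ℝ (Fin d) →L[ℝ] EuclideanSpace ℝ (Fin d) →L[ℝ] ℝ) x (val x))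

/-- A vector field is smooth. -/
def SmoothVectorField [IsManifold (𝓡 d) ∞ M] (X : Π x : M, TangentSpace (𝓡 d) x) : Prop :=
  ContMDiff (𝓡 d) ((𝓡 d).prod 𝓘(ℝ, EuclideanSpace ℝ (Fin d))) ∞
    (fun x => Bundle.TotalSpace.mk' (EuclideanSpace ℝ (Fin d)) x (X x))

/-- A 1-form is smooth. -/
def SmoothOneForm [IsManifold (𝓡 d) ∞ M] (α : Π x : M, TangentSpace (𝓡 d) x →L[ℝ] ℝ) : Prop :=
  ContMDiff (𝓡 d) ((𝓡 d).prod 𝓘(ℝ, EuclideanSpace ℝ (Fin d) →L[ℝ] ℝ)) ∞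
    (fun x => Bundle.TotalSpace.mk' (EuclideanSpace ℝ (Fin d) →L[ℝ] ℝ) x (α x))

/-- The derivative `v(f)` of a scalar function `f` at `x` along the tangent vector `v`. -/
def dirDeriv (f : M → ℝ) (x : M) (v : TangentSpace (𝓡 d) x) : ℝ :=
  mvfderiv (𝓡 d) f x v

/-- A vector field, smooth near `x`, that takes the value `v` at `x` (constant components in the
preferred chart at `x`). Every expression below in which it occurs is tensorial in the
corresponding slot, so that only the value `v` matters. -/
def extendVec [IsManifold (𝓡 d) ∞ M] {x : M} (v : TangentSpace (𝓡 d) x) :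
    Π y : M, TangentSpace (𝓡 d) y :=
  FiberBundle.extend (EuclideanSpace ℝ (Fin d)) v

/-- The `μ`-th coordinate basis vector of the tangent space at `x` (for the preferred chart). -/
def coordVec (x : M) (μ : Fin d) : TangentSpace (𝓡 d) x :=
  (EuclideanSpace.single μ (1 : ℝ) : EuclideanSpace ℝ (Fin d))

variable [IsManifold (𝓡 d) ∞ M]

namespace LorentzianMetric

variable (g : LorentzianMetric d M)

/-- The components `g_{μν}` at `x`. -/
def gram (x : M) : Matrix (Fin d) (Fin d) ℝ :=
  Matrix.of fun μ ν => g.val x (coordVec x μ) (coordVec x ν)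

/-- The components `g^{μν}` of the inverse metric at `x`. -/
def gramInv (x : M) : Matrix (Fin d) (Fin d) ℝ := (g.gram x)⁻¹

/-- Koszul's formula for `g(∇_X Y, Z)`. -/
def koszul (X Y Z : Π x : M, TangentSpace (𝓡 d) x) (x : M) : ℝ :=
  (1 / 2 : ℝ) *
    (dirDeriv (fun y => g.val y (Y y) (Z y)) x (X x)
      + dirDeriv (fun y => g.val y (Z y) (X y)) x (Y x)
      - dirDeriv (fun y => g.val y (X y) (Y y)) x (Z x)
      + g.val x (VectorField.mlieBracket (𝓡 d) X Y x) (Z x)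
      - g.val x (VectorField.mlieBracket (𝓡 d) Y Z x) (X x)
      + g.val x (VectorField.mlieBracket (𝓡 d) Z X x) (Y x))

/-- The Levi-Civita covariant derivative `∇_v Y` at `x` of a vector field `Y`: the vector with
`g(∇_v Y, Z) = koszul v Y Z` for all `Z`, obtained by raising the index with `g^{μν}`. -/
def nabla (x : M) (v : TangentSpace (𝓡 d) x) (Y : Π x : M, TangentSpace (𝓡 d) x) :
    TangentSpace (𝓡 d) x :=
  ∑ μ, ∑ ν, (g.gramInv x μ ν * g.koszul (extendVec v) Y (extendVec (coordVec x ν)) x) • coordVec x μ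

/-- `(ℓ, n, m_2, …, m_{d-1})` is a null frame of the tangent space at `x`; the `d - 2` spacelike
vectors are indexed by `Fin (d - 2)`. -/
structure IsNullFrame (x : M) (l n : TangentSpace (𝓡 d) x)
    (m : Fin (d - 2) → TangentSpace (𝓡 d) x) : Prop where
  l_l : g.val x l l = 0
  n_n : g.val x n n = 0
  l_n : g.val x l n = 1
  l_m : ∀ i, g.val x l (m i) = 0
  n_m : ∀ i, g.val x n (m i) = 0
  m_m : ∀ i j, g.val x (m i) (m j) = if i = j then 1 else 0

/-- `ℓ` is geodetic: `∇_ℓ ℓ` is everywhere proportional to `ℓ`. -/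
def IsGeodetic (l : Π x : M, TangentSpace (𝓡 d) x) : Prop :=
  ∃ c : M → ℝ, ∀ x, g.nabla x (l x) l = c x • l x

/-- The optical matrix `ρ_{ij} = m_i^μ m_j^ν ∇_ν ℓ_μ` of the vector field `ℓ` at `x`. -/
def opticalMatrix (l : Π x : M, TangentSpace (𝓡 d) x) (x : M)
    (m : Fin (d - 2) → TangentSpace (𝓡 d) x) : Matrix (Fin (d - 2)) (Fin (d - 2)) ℝ :=
  Matrix.of fun i j => g.val x (m i) (g.nabla x (m j) l)

end LorentzianMetric

/-! ### Gauge fields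

`𝔤` is a real Lie algebra with basis `t`; a `𝔤`-valued tensor is the family of its components
with respect to `t`. -/

section Gauge

variable {𝔤 : Type*} [LieRing 𝔤] [LieAlgebra ℝ 𝔤] {ι : Type*} [Fintype ι]
  (t : Module.Basis ι ℝ 𝔤)

/-- Structure constants `f^c_{ab}`, where `[t_a, t_b] = f^c_{ab} t_c`. (For the Hermitian
generators `T_a = i t_a` this is `[T_a, T_b] = i f^c_{ab} T_c`.) -/
def structConst (c a b : ι) : ℝ := t.repr ⁅t a, t b⁆ c

/-- The components `F^c(u, v)` at `x` of the field strength of the gauge field `A = A^a t_a`: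
`F^c_{μν} = ∇_μ A^c_ν - ∇_ν A^c_μ + f^c_{ab} A^a_μ A^b_ν`, where the antisymmetrised derivative
is the exterior derivative `X(A(Y)) - Y(A(X)) - A([X, Y])`. -/
def fieldStrength (A : ι → Π x : M, TangentSpace (𝓡 d) x →L[ℝ] ℝ) (c : ι) (x : M)
    (u v : TangentSpace (𝓡 d) x) : ℝ :=
  dirDeriv (fun y => A c y (extendVec v y)) x u
    - dirDeriv (fun y => A c y (extendVec u y)) x v
    - A c x (VectorField.mlieBracket (𝓡 d) (extendVec u) (extendVec v) x)
    + ∑ a, ∑ b, structConst t c a b * A a x u * A b x v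

/-- The components `(𝒟_u F)^c(v, w)` at `x` of the gauge covariant derivative of the field
strength: `(∇_u F^c)(v, w) + f^c_{ab} A^a(u) F^b(v, w)`. -/
def gaugeDeriv (g : LorentzianMetric d M) (A : ι → Π x : M, TangentSpace (𝓡 d) x →L[ℝ] ℝ)
    (c : ι) (x : M) (u v w : TangentSpace (𝓡 d) x) : ℝ :=
  dirDeriv (fun y => fieldStrength t A c y (extendVec v y) (extendVec w y)) x u
    - fieldStrength t A c x (g.nabla x u (extendVec v)) w
    - fieldStrength t A c x v (g.nabla x u (extendVec w))
    + ∑ a, ∑ b, structConst t c a b * A a x u * fieldStrength t A b x v w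

/-- The source-free Yang-Mills equation `𝒟^μ F_{μν} = g^{μλ} 𝒟_λ F_{μν} = 0`. -/
def IsYangMills (g : LorentzianMetric d M)
    (A : ι → Π x : M, TangentSpace (𝓡 d) x →L[ℝ] ℝ) : Prop :=
  ∀ (c : ι) (x : M) (w : TangentSpace (𝓡 d) x),
    ∑ μ, ∑ ν, g.gramInv x μ ν * gaugeDeriv t g A c x (coordVec x ν) (coordVec x μ) w = 0

/-- The field strength is non-vanishing: it is nonzero at every point. -/
def IsNonvanishing (A : ι → Π x : M, TangentSpace (𝓡 d) x →L[ℝ] ℝ) : Prop :=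
  ∀ x : M, ∃ (c : ι) (u v : TangentSpace (𝓡 d) x), fieldStrength t A c x u v ≠ 0

/-- The field strength is null (type N) and aligned with `ℓ`: at every point there is a null frame
`e_0 = ℓ, e_1 = n, e_i = m_i` in which all components of boost weight greater than `-1`, namely
`F_{0i}` (weight `1`), `F_{01}` and `F_{ij}` (weight `0`), vanish. -/
def IsNullAligned (g : LorentzianMetric d M) (A : ι → Π x : M, TangentSpace (𝓡 d) x →L[ℝ] ℝ)
    (l : Π x : M, TangentSpace (𝓡 d) x) : Prop :=
  ∀ x : M, ∃ (n : TangentSpace (𝓡 d) x) (m : Fin (d - 2) → TangentSpace (𝓡 d) x),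
    g.IsNullFrame x (l x) n m ∧
    ∀ c : ι, (∀ i, fieldStrength t A c x (l x) (m i) = 0) ∧
      fieldStrength t A c x (l x) n = 0 ∧
      ∀ i j, fieldStrength t A c x (m i) (m j) = 0

/-- The scalars `φ'_i^a = F^a_{1i} = F^a(n, m_i)`. -/
def phiPrime (A : ι → Π x : M, TangentSpace (𝓡 d) x →L[ℝ] ℝ) (a : ι) (x : M)
    (n : TangentSpace (𝓡 d) x) (m : Fin (d - 2) → TangentSpace (𝓡 d) x) (i : Fin (d - 2)) : ℝ :=
  fieldStrength t A a x n (m i)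

end Gauge

end NullYM

end
open NullYM

/-! Write `ℓ♭` for the covector `g(ℓ, ·)`. Nullity and alignment say that each `F^a` has the form
`ℓ♭ ∧ φ^a` with `φ^a(ℓ) = 0` (`IsNullAligned.exists_eq_wedge`). Two frame-free identities follow,
`F(ℓ, ·) = 0` and `ℓ♭ ∧ F = 0`. They hold at every point, so they can be differentiated covariantly,
giving `𝒟_κ F(ℓ, w) = -F(∇_κ ℓ, w)` and `𝒟_κ F(m_j, m_k) = (∇_κ ℓ)_j φ'_k - (∇_κ ℓ)_k φ'_j`
(`gaugeDeriv_left`, `gaugeDeriv_m_m`). These components of the derivative of `F` are thus algebraic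
in `∇ℓ` and `φ'`.

The theorem is then linear algebra applied to the field equation and the Bianchi identity `𝒟_[λ
F_μν] = 0`. Let `a_i` be the `m_i` component of `∇_ℓ ℓ`. Yang–Mills contracted with `ℓ` gives `a ·
φ' = 0`, and Bianchi on `(ℓ, m_i, m_j)` gives `a_[i φ'_j] = 0`. Hence `a` is both orthogonal and
parallel to a nonzero `φ'`, so `a = 0`. Yang–Mills contracted with `m_j` and Bianchi on `(ℓ, n,
m_j)` both contain the unknown `𝒟_ℓ F(n, m_j)`; eliminating it yields the eigenvector equation for
the symmetric part of `ρ`. Bianchi on `(m_i, m_j, m_k)` says `ρ_[ij φ'_k] = 0`, which dividing by a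
nonzero component of `φ'` solves for the skew part.

The rest is geometric groundwork. The definitions extend tangent vectors by constant components in
the preferred chart, whereas the argument differentiates along `ℓ` itself, so the Koszul expression,
the exterior derivative and `𝒟F` must be shown tensorial. The chosen extensions commute, which gives
torsion-freeness and the Bianchi identity. -/

set_option linter.unusedSectionVars false

namespace NullYM

open VectorField

/-! ### Coordinate vector fields -/

section CoordinateFields

variable {E : Type*} [NormedAddCommGroup E] [NormedSpace ℝ E] [CompleteSpace E]
  {H : Type*} [TopologicalSpace H] {I : ModelWithCorners ℝ E H} [I.Boundaryless]
  {N : Type*} [TopologicalSpace N] [ChartedSpace H N] [IsManifold I ∞ N]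

variable (I) in
/-- The vector field with constant components `w` in the preferred chart at `x`. -/
noncomputable def coordField (x : N) (w : E) (y : N) : TangentSpace I y :=
  (trivializationAt E (TangentSpace I : N → Type _) x).symm y w

/-- The trivialization of the tangent bundle at `x` acts on fibres as the derivative of the chart.
-/
lemma mfderiv_extChartAt_coordField {x y : N} (w : E) (hy : y ∈ (chartAt H x).source) :
    mfderiv I 𝓘(ℝ, E) (extChartAt I x) y (coordField I x w y) = w := by
  rw [← TangentBundle.continuousLinearMapAt_trivializationAt hy]
  have hy' : y ∈ (trivializationAt E (TangentSpace I : N → Type _) x).baseSet := by simpa using hy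
  have h := (trivializationAt E (TangentSpace I : N → Type _) x).continuousLinearMapAt_symmL
    (R := ℝ) hy' w
  rwa [Bundle.Trivialization.symmL_apply (hb := hy')] at h

lemma mdifferentiableAt_extChartAt_symm_of_boundaryless {x y : N} (hy : y ∈ (chartAt H x).source) :
    MDifferentiableAt 𝓘(ℝ, E) I (extChartAt I x).symm (extChartAt I x y) := by
  have h := mdifferentiableWithinAt_extChartAt_symm (I := I) (x := x)
    ((extChartAt I x).map_source (by simpa using hy))
  rwa [I.range_eq_univ, mdifferentiableWithinAt_univ] at h

lemma differentiableAt_comp_extChartAt_symm {f : N → ℝ} {x y : N}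
    (hy : y ∈ (chartAt H x).source) (hf : MDifferentiableAt I 𝓘(ℝ, ℝ) f y) :
    DifferentiableAt ℝ (f ∘ (extChartAt I x).symm) (extChartAt I x y) := by
  rw [← mdifferentiableAt_iff_differentiableAt]
  have hy' : (extChartAt I x).symm (extChartAt I x y) = y :=
    (extChartAt I x).left_inv (by simpa using hy)
  refine MDifferentiableAt.comp (I' := I) _ ?_
    (mdifferentiableAt_extChartAt_symm_of_boundaryless hy)
  rwa [hy']

/-- Turns derivatives along coordinate fields into ordinary partial derivatives of the function read
in the chart. -/
lemma mvfderiv_coordField {f : N → ℝ} {x y : N} (w : E)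
    (hy : y ∈ (chartAt H x).source) (hf : MDifferentiableAt I 𝓘(ℝ, ℝ) f y) :
    mvfderiv I f y (coordField I x w y)
      = fderiv ℝ (f ∘ (extChartAt I x).symm) (extChartAt I x y) w := by
  have hs : (extChartAt I x).source ∈ nhds y :=
    (isOpen_extChartAt_source x).mem_nhds (by simpa using hy)
  have h1 : f =ᶠ[nhds y] (f ∘ (extChartAt I x).symm) ∘ extChartAt I x := by
    filter_upwards [hs] with z hz
    simp only [Function.comp_apply, (extChartAt I x).left_inv hz]
  have h2 : mfderiv I 𝓘(ℝ, ℝ) f y =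
      mfderiv I 𝓘(ℝ, ℝ) ((f ∘ (extChartAt I x).symm) ∘ extChartAt I x) y := h1.mfderiv_eq
  have h3 := mfderiv_comp_apply (I := I) (I' := 𝓘(ℝ, E)) (I'' := 𝓘(ℝ, ℝ)) y
    (differentiableAt_comp_extChartAt_symm hy hf).mdifferentiableAt
    (mdifferentiableAt_extChartAt hy) (coordField I x w y)
  rw [mfderiv_extChartAt_coordField w hy, mfderiv_eq_fderiv] at h3
  exact (congrArg (fun L => L (coordField I x w y)) h2).trans h3

/-- A constant vector field on a vector space. -/
def constField (w : E) (z : E) : TangentSpace 𝓘(ℝ, E) z := w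

lemma lieBracketWithin_const (u v : E) :
    lieBracketWithin ℝ (fun _ : E => u) (fun _ => v) Set.univ = 0 := by
  ext z
  simp [lieBracketWithin]

/-- Coordinate fields are pullbacks of constant fields under the chart; the Lie bracket is natural
under pullback, and constant fields commute. -/
lemma mlieBracket_coordField {x y : N} (u v : E) (hy : y ∈ (chartAt H x).source) :
    mlieBracket I (coordField I x u) (coordField I x v) y = 0 := by
  have hs : (chartAt H x).source ∈ nhds y := (chartAt H x).open_source.mem_nhds hy
  have key : ∀ w : E, coordField I x w =ᶠ[nhds y]
      mpullback I 𝓘(ℝ, E) (extChartAt I x) (constField w) := by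
    intro w
    filter_upwards [hs] with z hz
    have hinv : (mfderiv I 𝓘(ℝ, E) (extChartAt I x) z).IsInvertible :=
      isInvertible_mfderiv_extChartAt (by simpa using hz)
    refine (hinv.inverse_apply_eq.2 ?_).symm
    exact (mfderiv_extChartAt_coordField w hz).symm
  have hdiff : ∀ w : E, MDifferentiableAt 𝓘(ℝ, E) (𝓘(ℝ, E).prod 𝓘(ℝ, E))
      (fun z : E => Bundle.TotalSpace.mk' E (E := (TangentSpace 𝓘(ℝ, E) : E → Type _)) z (constField w z))
      (extChartAt I x y) := fun w =>
    (contMDiffAt_vectorSpace_iff_contDiffAt (n := 1) (V := fun _ => w)|>.2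
      contDiffAt_const).mdifferentiableAt one_ne_zero
  have : IsManifold I (minSmoothness ℝ 2) N := by
    rw [minSmoothness_of_isRCLikeNormedField]; infer_instance
  rw [(key u).mlieBracket_vectorField_eq (key v), ← mpullback_mlieBracket (n := ∞)
    (hdiff u) (hdiff v) (contMDiffAt_extChartAt' hy)
    (by
    rw [minSmoothness_of_isRCLikeNormedField]
    exact WithTop.coe_le_coe.2 (le_top : (2 : ℕ∞) ≤ ⊤))]
  have h0 : mlieBracket 𝓘(ℝ, E) (constField u) (constField v) = 0 := by
    rw [← mlieBracketWithin_univ, mlieBracketWithin_eq_lieBracketWithin]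
    exact lieBracketWithin_const u v
  rw [h0, mpullback_zero]
  rfl

/-- The tangent space at `x` is modelled through the preferred chart at `x`, so the trivialization
there is the identity on the fibre over `x`. -/
lemma extend_eq_coordField {x : N} (v : TangentSpace I x) :
    FiberBundle.extend E v = coordField I x v := by
  have h : (trivializationAt E (TangentSpace I : N → Type _) x ⟨x, v⟩).2 = v := by
    have hx : x ∈ (trivializationAt E (TangentSpace I : N → Type _) x).baseSet :=
      FiberBundle.mem_baseSet_trivializationAt' x
    rw [← Bundle.Trivialization.continuousLinearMapAt_apply_of_mem ℝ _ hx,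
      TangentBundle.continuousLinearMapAt_trivializationAt_eq_core (mem_chart_source H x)]
    exact (tangentBundleCore I N).coordChange_self _ _ (mem_chart_source H x) v
  ext y
  exact congrArg (fun w : E => (trivializationAt E (TangentSpace I : N → Type _) x).symm y w) h

lemma contDiffAt_comp_extChartAt_symm {f : N → ℝ} {x : N} (hf : ContMDiffAt I 𝓘(ℝ, ℝ) ∞ f x) :
    ContDiffAt ℝ ∞ (f ∘ (extChartAt I x).symm) (extChartAt I x x) := by
  rw [← contMDiffAt_iff_contDiffAt]
  refine ContMDiffAt.comp (I' := I) _ (by rwa [extChartAt_to_inv]) ?_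
  exact (contMDiffOn_extChartAt_symm x).contMDiffAt (extChartAt_target_mem_nhds x)

lemma mvfderiv_coordField_eventuallyEq {f : N → ℝ} {x : N} (hf : ContMDiffAt I 𝓘(ℝ, ℝ) ∞ f x)
    (w : E) :
    (fun y => mvfderiv I f y (coordField I x w y)) =ᶠ[nhds x]
      (fun z => fderiv ℝ (f ∘ (extChartAt I x).symm) z w) ∘ extChartAt I x := by
  have h1 : ∀ᶠ y in nhds x, ContMDiffAt I 𝓘(ℝ, ℝ) 1 f y :=
    (contMDiffAt_iff_contMDiffAt_nhds (by simp)).1 (hf.of_le (by exact_mod_cast le_top))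
  filter_upwards [h1, (chartAt H x).open_source.mem_nhds (mem_chart_source H x)] with y hy hy'
  exact mvfderiv_coordField w hy' (hy.mdifferentiableAt one_ne_zero)

lemma contDiffAt_fderiv_comp_extChartAt_symm {f : N → ℝ} {x : N}
    (hf : ContMDiffAt I 𝓘(ℝ, ℝ) ∞ f x) (w : E) :
    ContDiffAt ℝ ∞ (fun z => fderiv ℝ (f ∘ (extChartAt I x).symm) z w) (extChartAt I x x) :=
  ((contDiffAt_comp_extChartAt_symm hf).fderiv_right (m := ∞) le_rfl).clm_apply contDiffAt_const

/-- Coordinate derivatives of a smooth function are smooth. -/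
lemma contMDiffAt_mvfderiv_coordField {f : N → ℝ} {x : N} (hf : ContMDiffAt I 𝓘(ℝ, ℝ) ∞ f x)
    (w : E) :
    ContMDiffAt I 𝓘(ℝ, ℝ) ∞ (fun y => mvfderiv I f y (coordField I x w y)) x :=
  ((contDiffAt_fderiv_comp_extChartAt_symm hf w).contMDiffAt.comp x
    contMDiffAt_extChartAt).congr_of_eventuallyEq (mvfderiv_coordField_eventuallyEq hf w)

/-- Coordinate derivatives of a smooth function commute. -/
lemma mvfderiv_mvfderiv_coordField_comm {f : N → ℝ} {x : N} (hf : ContMDiffAt I 𝓘(ℝ, ℝ) ∞ f x)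
    (u v : E) :
    mvfderiv I (fun y => mvfderiv I f y (coordField I x v y)) x (coordField I x u x)
      = mvfderiv I (fun y => mvfderiv I f y (coordField I x u y)) x (coordField I x v x) := by
  -- Both iterated derivatives are values of one second Fréchet derivative, whose symmetry
  -- concludes.
  have key : ∀ u v : E,
      mvfderiv I (fun y => mvfderiv I f y (coordField I x v y)) x (coordField I x u x)
        = fderiv ℝ (fderiv ℝ (f ∘ (extChartAt I x).symm)) (extChartAt I x x) u v := by
    intro u v
    rw [mvfderiv_coordField u (mem_chart_source H x)
      ((contMDiffAt_mvfderiv_coordField hf v).mdifferentiableAt (by simp))]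
    have h2 : (fun y => mvfderiv I f y (coordField I x v y)) ∘ (extChartAt I x).symm
        =ᶠ[nhds (extChartAt I x x)] fun z => fderiv ℝ (f ∘ (extChartAt I x).symm) z v := by
      have h3 := (continuousAt_extChartAt_symm (I := I) x).tendsto
      rw [extChartAt_to_inv] at h3
      filter_upwards [h3.eventually (mvfderiv_coordField_eventuallyEq hf v),
        extChartAt_target_mem_nhds x] with z hz hz'
      simp only [Function.comp_apply] at hz ⊢
      rw [hz, (extChartAt I x).right_inv hz']
    rw [h2.fderiv_eq]
    have h4 : DifferentiableAt ℝ (fderiv ℝ (f ∘ (extChartAt I x).symm)) (extChartAt I x x) :=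
      ((contDiffAt_comp_extChartAt_symm hf).fderiv_right (m := 1)
        (WithTop.coe_le_coe.2 le_top)).differentiableAt one_ne_zero
    rw [fderiv_clm_apply h4 (differentiableAt_const v)]
    simp
  rw [key, key]
  exact ((contDiffAt_comp_extChartAt_symm hf).isSymmSndFDerivAt (by
    rw [minSmoothness_of_isRCLikeNormedField]
    exact WithTop.coe_le_coe.2 (le_top : (2 : ℕ∞) ≤ ⊤))).eq u v

end CoordinateFields

/-- A scalar function is differentiable at a point of a `d`-dimensional manifold. -/
abbrev DiffFunAt (d : ℕ) {M : Type*} [TopologicalSpace M]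
    [ChartedSpace (EuclideanSpace ℝ (Fin d)) M] (f : M → ℝ) (x : M) : Prop :=
  MDifferentiableAt (𝓡 d) 𝓘(ℝ, ℝ) f x

/-- A vector field is differentiable at a point. -/
abbrev DiffFieldAt {d : ℕ} {M : Type*} [TopologicalSpace M]
    [ChartedSpace (EuclideanSpace ℝ (Fin d)) M] [IsManifold (𝓡 d) ∞ M]
    (Y : Π x : M, TangentSpace (𝓡 d) x) (x : M) : Prop :=
  MDifferentiableAt (𝓡 d) ((𝓡 d).prod 𝓘(ℝ, EuclideanSpace ℝ (Fin d)))
    (fun y => Bundle.TotalSpace.mk' (EuclideanSpace ℝ (Fin d)) y (Y y)) x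

variable {d : ℕ} {M : Type*} [TopologicalSpace M] [ChartedSpace (EuclideanSpace ℝ (Fin d)) M]
  [IsManifold (𝓡 d) ∞ M]

/-! ### Directional derivatives -/

lemma dirDeriv_add {f h : M → ℝ} {x : M} (hf : DiffFunAt d f x) (hh : DiffFunAt d h x)
    (v : TangentSpace (𝓡 d) x) :
    dirDeriv (fun y => f y + h y) x v = dirDeriv f x v + dirDeriv h x v := by
  simp [dirDeriv, mvfderiv_fun_add hf hh]

lemma dirDeriv_sub {f h : M → ℝ} {x : M} (hf : DiffFunAt d f x) (hh : DiffFunAt d h x)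
    (v : TangentSpace (𝓡 d) x) :
    dirDeriv (fun y => f y - h y) x v = dirDeriv f x v - dirDeriv h x v := by
  simp [dirDeriv, mvfderiv_fun_sub hf hh]

lemma dirDeriv_mul {f h : M → ℝ} {x : M} (hf : DiffFunAt d f x) (hh : DiffFunAt d h x)
    (v : TangentSpace (𝓡 d) x) :
    dirDeriv (fun y => f y * h y) x v = f x * dirDeriv h x v + h x * dirDeriv f x v := by
  simp [dirDeriv, mvfderiv_fun_mul hf hh]

lemma dirDeriv_const (c : ℝ) (x : M) (v : TangentSpace (𝓡 d) x) :
    dirDeriv (fun _ : M => c) x v = 0 := by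
  simp [dirDeriv, mvfderiv_const]

lemma dirDeriv_congr {f h : M → ℝ} {x : M} (hfh : f =ᶠ[nhds x] h) (v : TangentSpace (𝓡 d) x) :
    dirDeriv f x v = dirDeriv h x v := by
  simp only [dirDeriv, mvfderiv, hfh.mfderiv_eq]
  rfl

lemma dirDeriv_sum {κ : Type*} (s : Finset κ) {f : κ → M → ℝ} {x : M}
    (hf : ∀ i, DiffFunAt d (f i) x) (v : TangentSpace (𝓡 d) x) :
    DiffFunAt d (fun y => ∑ i ∈ s, f i y) x ∧
    dirDeriv (fun y => ∑ i ∈ s, f i y) x v = ∑ i ∈ s, dirDeriv (f i) x v := by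
  classical
  induction s using Finset.induction_on with
  | empty => simpa using ⟨mdifferentiableAt_const, dirDeriv_const 0 x v⟩
  | insert a s ha ih =>
    simp only [Finset.sum_insert ha]
    exact ⟨(hf a).add ih.1, by rw [dirDeriv_add (hf a) ih.1, ih.2]⟩

/-! ### Extensions of tangent vectors -/

lemma diffFieldAt_extendVec {x : M} (v : TangentSpace (𝓡 d) x) : DiffFieldAt (extendVec v) x :=
  FiberBundle.mdifferentiableAt_extend ..

lemma contMDiffAt_extendVec {x : M} (v : TangentSpace (𝓡 d) x) :
    ContMDiffAt (𝓡 d) ((𝓡 d).prod 𝓘(ℝ, EuclideanSpace ℝ (Fin d))) ∞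
      (fun y => Bundle.TotalSpace.mk' (EuclideanSpace ℝ (Fin d)) y (extendVec v y)) x :=
  FiberBundle.contMDiffAt_extend ..

lemma eventually_diffFieldAt_extendVec {x : M} (v : TangentSpace (𝓡 d) x) :
    ∀ᶠ y in nhds x, DiffFieldAt (extendVec v) y := by
  have h : ContMDiffAt (𝓡 d) ((𝓡 d).prod 𝓘(ℝ, EuclideanSpace ℝ (Fin d))) 1
      (fun y => Bundle.TotalSpace.mk' (EuclideanSpace ℝ (Fin d)) y (extendVec v y)) x :=
    FiberBundle.contMDiffAt_extend ..
  filter_upwards [(contMDiffAt_iff_contMDiffAt_nhds (by simp)).1 h] with y hy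
  exact hy.mdifferentiableAt one_ne_zero

@[simp] lemma extendVec_self {x : M} (v : TangentSpace (𝓡 d) x) : extendVec v x = v := by
  simp [extendVec]

lemma extendVec_eq_coordField {x : M} (v : TangentSpace (𝓡 d) x) :
    extendVec v = coordField (𝓡 d) x v :=
  extend_eq_coordField v

lemma eventually_mem_chart_source (d : ℕ) {M : Type*} [TopologicalSpace M]
    [ChartedSpace (EuclideanSpace ℝ (Fin d)) M] (x : M) :
    ∀ᶠ y in nhds x, y ∈ (chartAt (EuclideanSpace ℝ (Fin d)) x).source :=
  (chartAt (EuclideanSpace ℝ (Fin d)) x).open_source.mem_nhds (mem_chart_source _ x)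

lemma mlieBracket_extendVec {x y : M} (u v : TangentSpace (𝓡 d) x)
    (hy : y ∈ (chartAt (EuclideanSpace ℝ (Fin d)) x).source) :
    mlieBracket (𝓡 d) (extendVec u) (extendVec v) y = 0 := by
  rw [extendVec_eq_coordField, extendVec_eq_coordField]
  exact mlieBracket_coordField (E := EuclideanSpace ℝ (Fin d)) u v hy

lemma contMDiffAt_dirDeriv_extendVec {f : M → ℝ} {x : M}
    (hf : ContMDiffAt (𝓡 d) 𝓘(ℝ, ℝ) ∞ f x) (v : TangentSpace (𝓡 d) x) :
    ContMDiffAt (𝓡 d) 𝓘(ℝ, ℝ) ∞ (fun y => dirDeriv f y (extendVec v y)) x := by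
  rw [extendVec_eq_coordField]
  exact contMDiffAt_mvfderiv_coordField hf v

lemma dirDeriv_dirDeriv_extendVec_comm {f : M → ℝ} {x : M}
    (hf : ContMDiffAt (𝓡 d) 𝓘(ℝ, ℝ) ∞ f x) (u v : TangentSpace (𝓡 d) x) :
    dirDeriv (fun y => dirDeriv f y (extendVec v y)) x u
      = dirDeriv (fun y => dirDeriv f y (extendVec u y)) x v := by
  have h := mvfderiv_mvfderiv_coordField_comm hf u v
  rw [← extendVec_eq_coordField, ← extendVec_eq_coordField, extendVec_self, extendVec_self] at h
  exact h

/-- Near `x`, a differentiable vector field is a combination of coordinate fields with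
differentiable coefficients. -/
lemma DiffFieldAt.exists_coeff {Y : Π x : M, TangentSpace (𝓡 d) x} {x : M}
    (hY : DiffFieldAt Y x) :
    ∃ c : Fin d → M → ℝ, (∀ i, DiffFunAt d (c i) x) ∧
      ∀ᶠ y in nhds x, Y y = ∑ i, c i y • extendVec (coordVec x i) y := by
  let e := trivializationAt (EuclideanSpace ℝ (Fin d)) (TangentSpace (𝓡 d) : M → Type _) x
  let b := (EuclideanSpace.basisFun (Fin d) ℝ).toBasis
  have hx : x ∈ e.baseSet := FiberBundle.mem_baseSet_trivializationAt' x
  refine ⟨fun i y => e.localFrameCoeff (𝓡 d) b i y (Y y),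
    fun i => mdifferentiableAt_localFrameCoeff b hx hY i, ?_⟩
  filter_upwards [e.open_baseSet.mem_nhds hx] with y hy
  refine (e.eq_sum_localFrameCoeff_smul (I := 𝓡 d) (b := b) (s := Y) hy).trans
    (Finset.sum_congr rfl fun i _ => ?_)
  congr 1
  rw [e.localFrame_apply_of_mem_baseSet b hy, extendVec_eq_coordField]
  simp [Bundle.Trivialization.basisAt, b, coordField, coordVec, e]

lemma DiffFieldAt.add {X Y : Π x : M, TangentSpace (𝓡 d) x} {x : M} (hX : DiffFieldAt X x)
    (hY : DiffFieldAt Y x) : DiffFieldAt (X + Y) x :=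
  mdifferentiableAt_add_section hX hY

lemma DiffFieldAt.smul {f : M → ℝ} {Y : Π x : M, TangentSpace (𝓡 d) x} {x : M}
    (hf : DiffFunAt d f x) (hY : DiffFieldAt Y x) : DiffFieldAt (f • Y) x :=
  hf.smul_section hY

lemma DiffFunAt.fun_add {f h : M → ℝ} {x : M} (hf : DiffFunAt d f x) (hh : DiffFunAt d h x) :
    DiffFunAt d (fun y => f y + h y) x :=
  MDifferentiableAt.add hf hh

lemma DiffFunAt.fun_mul {f h : M → ℝ} {x : M} (hf : DiffFunAt d f x) (hh : DiffFunAt d h x) :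
    DiffFunAt d (fun y => f y * h y) x :=
  MDifferentiableAt.mul hf hh

lemma SmoothVectorField.diffFieldAt {Y : Π x : M, TangentSpace (𝓡 d) x}
    (hY : SmoothVectorField Y) (x : M) : DiffFieldAt Y x :=
  (hY x).mdifferentiableAt (by simp)

lemma dirDeriv_vec_add (f : M → ℝ) (x : M) (u v : TangentSpace (𝓡 d) x) :
    dirDeriv f x (u + v) = dirDeriv f x u + dirDeriv f x v :=
  map_add (mvfderiv (𝓡 d) f x) u v

lemma dirDeriv_vec_smul (f : M → ℝ) (x : M) (c : ℝ) (v : TangentSpace (𝓡 d) x) :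
    dirDeriv f x (c • v) = c * dirDeriv f x v :=
  map_smul (mvfderiv (𝓡 d) f x) c v

lemma SmoothOneForm.contMDiffAt_apply {α : Π x : M, TangentSpace (𝓡 d) x →L[ℝ] ℝ}
    (hα : SmoothOneForm α) {Y : Π x : M, TangentSpace (𝓡 d) x} {x : M}
    (hY : ContMDiffAt (𝓡 d) ((𝓡 d).prod 𝓘(ℝ, EuclideanSpace ℝ (Fin d))) ∞
      (fun y => Bundle.TotalSpace.mk' (EuclideanSpace ℝ (Fin d)) y (Y y)) x) :
    ContMDiffAt (𝓡 d) 𝓘(ℝ, ℝ) ∞ (fun y => α y (Y y)) x := by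
  have h := ContMDiffAt.clm_bundle_apply (F₂ := ℝ) (E₂ := fun _ : M => ℝ) (b := fun y : M => y)
    (ϕ := α) (v := Y) (hα x) hY
  exact (Bundle.contMDiffAt_totalSpace.1 h).2

lemma SmoothOneForm.diffFunAt_apply {α : Π x : M, TangentSpace (𝓡 d) x →L[ℝ] ℝ}
    (hα : SmoothOneForm α) {Y : Π x : M, TangentSpace (𝓡 d) x} {x : M}
    (hY : DiffFieldAt Y x) :
    DiffFunAt d (fun y => α y (Y y)) x := by
  have h := MDifferentiableAt.clm_bundle_apply (F₂ := ℝ) (E₂ := fun _ : M => ℝ)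
    (b := fun y : M => y) (ϕ := α) (v := Y) ((hα x).mdifferentiableAt (by simp)) hY
  exact ((mdifferentiableAt_totalSpace _ _).1 h).2

lemma exists_eq_sum_coordVec {x : M} (v : TangentSpace (𝓡 d) x) :
    ∃ c : Fin d → ℝ, v = ∑ i, c i • coordVec x i := by
  let w : EuclideanSpace ℝ (Fin d) := v
  refine ⟨fun i => w i, ?_⟩
  exact (by simpa using ((EuclideanSpace.basisFun (Fin d) ℝ).sum_repr w).symm :
    w = ∑ i, w i • EuclideanSpace.single i (1 : ℝ))

lemma sum_coordVec_eq_zero {x : M} {c : Fin d → ℝ}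
    (h : ∑ i, c i • coordVec x i = (0 : TangentSpace (𝓡 d) x)) : c = 0 := by
  have h' : ∑ i, c i • EuclideanSpace.single i (1 : ℝ) = (0 : EuclideanSpace ℝ (Fin d)) := h
  ext i
  have h2 := congrArg (fun w : EuclideanSpace ℝ (Fin d) => w i) h'
  simpa [Pi.single_apply] using h2

/-! ### The Levi-Civita connection from Koszul's formula -/

namespace LorentzianMetric

variable (g : LorentzianMetric d M)

lemma diffFunAt_apply {X Y : Π x : M, TangentSpace (𝓡 d) x} {x : M}
    (hX : DiffFieldAt X x) (hY : DiffFieldAt Y x) :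
    DiffFunAt d (fun y => g.val y (X y) (Y y)) x := by
  have h := MDifferentiableAt.clm_bundle_apply₂ (F₁ := EuclideanSpace ℝ (Fin d))
    (F₂ := EuclideanSpace ℝ (Fin d)) (F₃ := ℝ) (E₃ := fun _ : M => ℝ)
    (b := fun y : M => y) (ψ := g.val) (v := X) (w := Y)
    ((g.smooth x).mdifferentiableAt (by simp)) hX hY
  exact ((mdifferentiableAt_totalSpace _ _).1 h).2

/-- Nondegeneracy: pairing with a basis vector of the signature basis reads off that coordinate up
to sign. -/
lemma eq_zero_of_forall {x : M} {v : TangentSpace (𝓡 d) x} (h : ∀ z, g.val x v z = 0) :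
    v = 0 := by
  obtain ⟨e, he⟩ := g.signature x
  refine e.ext_elem fun i => ?_
  have h1 := h (e i)
  rw [← e.sum_repr v] at h1
  simp only [map_sum, map_smul, _root_.sum_apply, _root_.smul_apply, he,
    smul_eq_mul] at h1
  simp only [mul_ite, mul_zero, Finset.sum_ite_eq', Finset.mem_univ, if_true] at h1
  simp only [map_zero, Finsupp.coe_zero, Pi.zero_apply]
  split_ifs at h1 <;> linarith

lemma eq_of_forall {x : M} {v w : TangentSpace (𝓡 d) x}
    (h : ∀ z, g.val x v z = g.val x w z) : v = w := by
  rw [← sub_eq_zero]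
  exact g.eq_zero_of_forall fun z => by simp [h z]

/-- A nonzero kernel vector of the Gram matrix would be a nonzero tangent vector orthogonal to
everything. -/
lemma gramInv_mul_gram (x : M) : g.gramInv x * g.gram x = 1 := by
  refine Matrix.nonsing_inv_mul _ ?_
  rw [isUnit_iff_ne_zero]
  intro h0
  obtain ⟨c, hc, hc0⟩ := Matrix.exists_vecMul_eq_zero_iff.2 h0
  refine hc ?_
  have h1 : ∑ μ, c μ • coordVec x μ = (0 : TangentSpace (𝓡 d) x) := by
    refine g.eq_zero_of_forall fun z => ?_
    obtain ⟨b, rfl⟩ := exists_eq_sum_coordVec z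
    rw [map_sum]
    refine Finset.sum_eq_zero fun ν _ => ?_
    have h2 := congrFun hc0 ν
    simp only [Matrix.vecMul, dotProduct, gram, Matrix.of_apply, Pi.zero_apply] at h2
    simp [h2]
  exact sum_coordVec_eq_zero h1

/-- Raising the index of a covector. -/
lemma val_raise {x : M} (k : TangentSpace (𝓡 d) x →ₗ[ℝ] ℝ) (z : TangentSpace (𝓡 d) x) :
    g.val x (∑ μ, ∑ ν, (g.gramInv x μ ν * k (coordVec x ν)) • coordVec x μ) z = k z := by
  have hsymm : ∀ μ ν, g.gramInv x μ ν = g.gramInv x ν μ := by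
    have h : (g.gram x).transpose = g.gram x := by
      ext μ ν
      simp [gram, g.symm x (coordVec x ν)]
    intro μ ν
    conv_rhs => rw [gramInv, ← h, ← Matrix.transpose_nonsing_inv]
    rfl
  obtain ⟨b, rfl⟩ := exists_eq_sum_coordVec z
  have h1 : ∀ ν κ, ∑ μ, g.gramInv x ν μ * g.gram x μ κ = if ν = κ then 1 else 0 := by
    intro ν κ
    have h := congrFun (congrFun (g.gramInv_mul_gram x) ν) κ
    rwa [Matrix.mul_apply, Matrix.one_apply] at h
  rw [map_sum (g.val x _), map_sum k]
  refine Finset.sum_congr rfl fun κ _ => ?_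
  rw [map_smul, map_smul]
  congr 1
  calc g.val x (∑ μ, ∑ ν, (g.gramInv x μ ν * k (coordVec x ν)) • coordVec x μ) (coordVec x κ)
      = ∑ μ, ∑ ν, g.gramInv x μ ν * k (coordVec x ν) * g.gram x μ κ := by
        simp [gram]
    _ = ∑ ν, k (coordVec x ν) * ∑ μ, g.gramInv x ν μ * g.gram x μ κ := by
        rw [Finset.sum_comm]
        refine Finset.sum_congr rfl fun ν _ => ?_
        rw [Finset.mul_sum]
        refine Finset.sum_congr rfl fun μ _ => ?_
        rw [hsymm μ ν]
        ring
    _ = _ := by simp [h1]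

lemma raise_lower {x : M} (a : TangentSpace (𝓡 d) x) :
    ∑ μ, ∑ ν, (g.gramInv x μ ν * g.val x (coordVec x ν) a) • coordVec x μ = a := by
  refine g.eq_of_forall fun z => ?_
  have h := g.val_raise (x := x) (g.val x a : TangentSpace (𝓡 d) x →ₗ[ℝ] ℝ) z
  simpa [g.symm x a] using h

/-- The derivatives of the scalar factor coming from the metric terms cancel those coming from the
brackets. This frees the connection from the particular extension in its definition. -/
lemma koszul_tensorialAt_left {x : M} {Y Z : Π x : M, TangentSpace (𝓡 d) x}
    (hY : DiffFieldAt Y x) (hZ : DiffFieldAt Z x) :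
    TensorialAt (𝓡 d) (EuclideanSpace ℝ (Fin d)) (fun X => g.koszul X Y Z x) x where
  smul := by
    intro f X hf hX
    simp only [koszul, Pi.smul_apply', map_smul, _root_.smul_apply, smul_eq_mul,
      dirDeriv_vec_smul]
    rw [mlieBracket_smul_left hf hX, mlieBracket_smul_right hf hX,
      dirDeriv_mul hf (g.diffFunAt_apply hZ hX), dirDeriv_mul hf (g.diffFunAt_apply hX hY)]
    simp only [dirDeriv, map_add, map_smul, _root_.add_apply, map_neg,
      _root_.smul_apply, smul_eq_mul, neg_smul, _root_.neg_apply, g.symm x (X x)]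
    ring
  add := by
    intro X X' hX hX'
    simp only [koszul, Pi.add_apply, map_add, _root_.add_apply, dirDeriv_vec_add]
    rw [mlieBracket_add_left hX hX', mlieBracket_add_right hX hX',
      dirDeriv_add (g.diffFunAt_apply hZ hX) (g.diffFunAt_apply hZ hX'),
      dirDeriv_add (g.diffFunAt_apply hX hY) (g.diffFunAt_apply hX' hY)]
    simp only [map_add, _root_.add_apply]
    ring

lemma koszul_tensorialAt_right {x : M} {X Y : Π x : M, TangentSpace (𝓡 d) x}
    (hX : DiffFieldAt X x) (hY : DiffFieldAt Y x) :
    TensorialAt (𝓡 d) (EuclideanSpace ℝ (Fin d)) (fun Z => g.koszul X Y Z x) x where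
  smul := by
    intro f Z hf hZ
    simp only [koszul, Pi.smul_apply', map_smul, _root_.smul_apply, smul_eq_mul,
      dirDeriv_vec_smul]
    rw [mlieBracket_smul_left hf hZ, mlieBracket_smul_right hf hZ,
      dirDeriv_mul hf (g.diffFunAt_apply hZ hX), dirDeriv_mul hf (g.diffFunAt_apply hY hZ)]
    simp only [dirDeriv, map_add, map_smul, _root_.add_apply, map_neg,
      _root_.smul_apply, smul_eq_mul, neg_smul, _root_.neg_apply,
      g.symm x (Z x)]
    ring
  add := by
    intro Z Z' hZ hZ'
    simp only [koszul, Pi.add_apply, map_add, _root_.add_apply, dirDeriv_vec_add]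
    rw [mlieBracket_add_left hZ hZ', mlieBracket_add_right hZ hZ',
      dirDeriv_add (g.diffFunAt_apply hZ hX) (g.diffFunAt_apply hZ' hX),
      dirDeriv_add (g.diffFunAt_apply hY hZ) (g.diffFunAt_apply hY hZ')]
    simp only [map_add, _root_.add_apply]
    ring

/-- The defining property of the Levi-Civita derivative. -/
lemma val_nabla {x : M} {X Y Z : Π x : M, TangentSpace (𝓡 d) x} (hX : DiffFieldAt X x)
    (hY : DiffFieldAt Y x) (hZ : DiffFieldAt Z x) :
    g.val x (g.nabla x (X x) Y) (Z x) = g.koszul X Y Z x := by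
  have h1 := g.koszul_tensorialAt_right (diffFieldAt_extendVec (X x)) hY
  -- First `X` is replaced by the extension of `X x`; tensoriality in `Z` then supplies the covector
  -- whose index is raised.
  rw [← (g.koszul_tensorialAt_left hY hZ).pointwise (diffFieldAt_extendVec (X x)) hX
    (extendVec_self _), ← TensorialAt.mkHom_apply h1 hZ]
  exact g.val_raise (TensorialAt.mkHom _ x h1).toLinearMap (Z x)

lemma val_nabla_extendVec {x : M} (v z : TangentSpace (𝓡 d) x) {Y : Π x : M, TangentSpace (𝓡 d) x}
    (hY : DiffFieldAt Y x) :
    g.val x (g.nabla x v Y) z = g.koszul (extendVec v) Y (extendVec z) x := by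
  have h := g.val_nabla (diffFieldAt_extendVec v) hY (diffFieldAt_extendVec z)
  rwa [extendVec_self, extendVec_self] at h

/-- Metric compatibility. -/
lemma dirDeriv_val {x : M} (v : TangentSpace (𝓡 d) x) {Y Z : Π x : M, TangentSpace (𝓡 d) x}
    (hY : DiffFieldAt Y x) (hZ : DiffFieldAt Z x) :
    dirDeriv (fun y => g.val y (Y y) (Z y)) x v
      = g.val x (g.nabla x v Y) (Z x) + g.val x (Y x) (g.nabla x v Z) := by
  have h1 := g.val_nabla (diffFieldAt_extendVec v) hY hZ
  have h2 := g.val_nabla (diffFieldAt_extendVec v) hZ hY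
  rw [extendVec_self] at h1 h2
  rw [g.symm x (Y x), h1, h2]
  have h3 : (fun y => g.val y (Z y) (Y y)) = fun y => g.val y (Y y) (Z y) :=
    funext fun y => g.symm y _ _
  have h4 : ∀ U W : Π x : M, TangentSpace (𝓡 d) x, mlieBracket (𝓡 d) U W x =
    - mlieBracket (𝓡 d) W U x := fun U W => mlieBracket_swap_apply
  have h5 : ∀ W : Π x : M, TangentSpace (𝓡 d) x, (fun y => g.val y (extendVec v y) (W y)) =
    fun y => g.val y (W y) (extendVec v y) := fun W => funext fun y => g.symm y _ _
  simp only [koszul, h3, h5, extendVec_self]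
  rw [h4 Z Y, h4 (extendVec v) Z, h4 (extendVec v) Y]
  simp only [map_neg, _root_.neg_apply]
  ring

/-- The Levi-Civita derivative is torsion free. -/
lemma nabla_extendVec_symm {x : M} (u v : TangentSpace (𝓡 d) x) :
    g.nabla x u (extendVec v) = g.nabla x v (extendVec u) := by
  refine g.eq_of_forall fun z => ?_
  rw [g.val_nabla_extendVec u z (diffFieldAt_extendVec v),
    g.val_nabla_extendVec v z (diffFieldAt_extendVec u)]
  have h3 : ∀ u v : TangentSpace (𝓡 d) x, mlieBracket (𝓡 d) (extendVec u) (extendVec v) x = 0 :=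
    fun u v => mlieBracket_extendVec u v (mem_chart_source _ x)
  have h5 : ∀ u v : TangentSpace (𝓡 d) x, (fun y => g.val y (extendVec v y) (extendVec u y)) =
    fun y => g.val y (extendVec u y) (extendVec v y) := fun u v => funext fun y => g.symm y _ _
  simp only [koszul, h3, map_zero, _root_.zero_apply]
  rw [h5 z v, h5 z u, h5 u v]
  ring

lemma nabla_smul {x : M} (v : TangentSpace (𝓡 d) x) {f : M → ℝ}
    {Y : Π x : M, TangentSpace (𝓡 d) x} (hf : DiffFunAt d f x) (hY : DiffFieldAt Y x) :
    g.nabla x v (f • Y) = dirDeriv f x v • Y x + f x • g.nabla x v Y := by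
  refine g.eq_of_forall fun z => ?_
  have hv := diffFieldAt_extendVec v
  have hz := diffFieldAt_extendVec z
  rw [map_add, map_smul, map_smul, _root_.add_apply, _root_.smul_apply,
    _root_.smul_apply, g.val_nabla_extendVec v z (hf.smul_section hY),
    g.val_nabla_extendVec v z hY]
  simp only [koszul, Pi.smul_apply', map_smul, _root_.smul_apply, smul_eq_mul,
    dirDeriv_vec_smul]
  rw [mlieBracket_smul_left hf hY, mlieBracket_smul_right hf hY,
    dirDeriv_mul hf (g.diffFunAt_apply hY hz), dirDeriv_mul hf (g.diffFunAt_apply hv hY)]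
  simp only [dirDeriv, map_add, map_smul, _root_.add_apply, map_neg,
    _root_.smul_apply, smul_eq_mul, neg_smul, _root_.neg_apply,
    g.symm x v, extendVec_self]
  ring

lemma nabla_add {x : M} (v : TangentSpace (𝓡 d) x) {Y Y' : Π x : M, TangentSpace (𝓡 d) x}
    (hY : DiffFieldAt Y x) (hY' : DiffFieldAt Y' x) :
    g.nabla x v (Y + Y') = g.nabla x v Y + g.nabla x v Y' := by
  refine g.eq_of_forall fun z => ?_
  have hv := diffFieldAt_extendVec v
  have hz := diffFieldAt_extendVec z
  rw [map_add, _root_.add_apply, g.val_nabla_extendVec v z (hY.add hY'),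
    g.val_nabla_extendVec v z hY, g.val_nabla_extendVec v z hY']
  simp only [koszul, Pi.add_apply, map_add, _root_.add_apply, dirDeriv_vec_add]
  rw [mlieBracket_add_left hY hY', mlieBracket_add_right hY hY',
    dirDeriv_add (g.diffFunAt_apply hY hz) (g.diffFunAt_apply hY' hz),
    dirDeriv_add (g.diffFunAt_apply hv hY) (g.diffFunAt_apply hv hY')]
  simp only [map_add, _root_.add_apply]
  ring

lemma nabla_vec_add {x : M} (u v : TangentSpace (𝓡 d) x) {Y : Π x : M, TangentSpace (𝓡 d) x}
    (hY : DiffFieldAt Y x) : g.nabla x (u + v) Y = g.nabla x u Y + g.nabla x v Y := by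
  refine g.eq_of_forall fun z => ?_
  have h := (g.koszul_tensorialAt_left hY (diffFieldAt_extendVec z)).add
    (diffFieldAt_extendVec u) (diffFieldAt_extendVec v)
  have h' := g.val_nabla ((diffFieldAt_extendVec u).add (diffFieldAt_extendVec v)) hY
    (diffFieldAt_extendVec z)
  rw [map_add, _root_.add_apply, g.val_nabla_extendVec u z hY,
    g.val_nabla_extendVec v z hY, ← h, ← h']
  simp

lemma nabla_vec_smul {x : M} (c : ℝ) (v : TangentSpace (𝓡 d) x)
    {Y : Π x : M, TangentSpace (𝓡 d) x} (hY : DiffFieldAt Y x) :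
    g.nabla x (c • v) Y = c • g.nabla x v Y := by
  refine g.eq_of_forall fun z => ?_
  have hc : DiffFunAt d (fun _ : M => c) x := mdifferentiableAt_const
  have h := (g.koszul_tensorialAt_left hY (diffFieldAt_extendVec z)).smul hc
    (diffFieldAt_extendVec v)
  have h' := g.val_nabla (DiffFieldAt.smul hc (diffFieldAt_extendVec v)) hY
    (diffFieldAt_extendVec z)
  rw [map_smul, _root_.smul_apply, g.val_nabla_extendVec v z hY]
  refine Eq.trans ?_ (h'.trans h)
  simp

end LorentzianMetric

/-! ### The exterior derivative of a 1-form -/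

/-- The exterior derivative `X(α(Y)) - Y(α(X)) - α([X, Y])` of a 1-form. -/
noncomputable def formDeriv (α : Π x : M, TangentSpace (𝓡 d) x →L[ℝ] ℝ)
    (X Y : Π x : M, TangentSpace (𝓡 d) x) (x : M) : ℝ :=
  dirDeriv (fun y => α y (Y y)) x (X x) - dirDeriv (fun y => α y (X y)) x (Y x)
    - α x (mlieBracket (𝓡 d) X Y x)

section FormDeriv

variable {α : Π x : M, TangentSpace (𝓡 d) x →L[ℝ] ℝ} (hα : SmoothOneForm α)

include hα

lemma formDeriv_tensorialAt_left (x : M) (Y : Π x : M, TangentSpace (𝓡 d) x) :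
    TensorialAt (𝓡 d) (EuclideanSpace ℝ (Fin d)) (fun X => formDeriv α X Y x) x where
  smul := by
    intro f X hf hX
    simp only [formDeriv, Pi.smul_apply', map_smul, smul_eq_mul, dirDeriv_vec_smul]
    rw [mlieBracket_smul_left hf hX, dirDeriv_mul hf (hα.diffFunAt_apply hX)]
    simp only [dirDeriv, map_add, map_smul, smul_eq_mul, neg_smul, map_neg]
    ring
  add := by
    intro X X' hX hX'
    simp only [formDeriv, Pi.add_apply, map_add, dirDeriv_vec_add]
    rw [mlieBracket_add_left hX hX',
      dirDeriv_add (hα.diffFunAt_apply hX) (hα.diffFunAt_apply hX')]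
    simp only [map_add]
    ring

lemma formDeriv_tensorialAt_right (x : M) (X : Π x : M, TangentSpace (𝓡 d) x) :
    TensorialAt (𝓡 d) (EuclideanSpace ℝ (Fin d)) (fun Y => formDeriv α X Y x) x where
  smul := by
    intro f Y hf hY
    simp only [formDeriv, Pi.smul_apply', map_smul, smul_eq_mul, dirDeriv_vec_smul]
    rw [mlieBracket_smul_right hf hY, dirDeriv_mul hf (hα.diffFunAt_apply hY)]
    simp only [dirDeriv, map_add, map_smul, smul_eq_mul]
    ring
  add := by
    intro Y Y' hY hY'
    simp only [formDeriv, Pi.add_apply, map_add, dirDeriv_vec_add]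
    rw [mlieBracket_add_right hY hY',
      dirDeriv_add (hα.diffFunAt_apply hY) (hα.diffFunAt_apply hY')]
    simp only [map_add]
    ring

/-- The exterior derivative depends only on the values of the fields at `x`, so any differentiable
extensions may be used. -/
lemma formDeriv_bilin (x : M) :
    ∃ B : TangentSpace (𝓡 d) x →L[ℝ] TangentSpace (𝓡 d) x →L[ℝ] ℝ,
      ∀ X Y : Π x : M, TangentSpace (𝓡 d) x, DiffFieldAt X x → DiffFieldAt Y x →
        formDeriv α X Y x = B (X x) (Y x) :=
  ⟨TensorialAt.mkHom₂ (fun X Y => formDeriv α X Y x) x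
      (fun Y _ => formDeriv_tensorialAt_left hα x Y)
      (fun X _ => formDeriv_tensorialAt_right hα x X),
    fun _ _ hX hY => (TensorialAt.mkHom₂_apply (Φ := fun X Y => formDeriv α X Y x) _ _ hX hY).symm⟩

end FormDeriv

section Gauge

variable {𝔤 : Type*} [LieRing 𝔤] [LieAlgebra ℝ 𝔤] {ι : Type*} [Fintype ι]
  (t : Module.Basis ι ℝ 𝔤)

/-! ### The Lie bracket in components -/

/-- The components `f^c_{ab} p^a q^b` of the bracket of `p^a t_a` and `q^b t_b`. -/
noncomputable def bracketCoord (c : ι) (p q : ι → ℝ) : ℝ :=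
  ∑ a, ∑ b, structConst t c a b * p a * q b

lemma bracketCoord_eq_repr (c : ι) (p q : ι → ℝ) :
    bracketCoord t c p q = t.repr ⁅∑ a, p a • t a, ∑ b, q b • t b⁆ c := by
  simp only [bracketCoord, structConst, lie_sum, sum_lie, lie_smul, smul_lie, map_sum,
    map_smul, Finsupp.coe_finsetSum, Finset.sum_apply, Finsupp.smul_apply, smul_eq_mul, Finset.mul_sum]
  rw [Finset.sum_comm]
  refine Finset.sum_congr rfl fun a _ => Finset.sum_congr rfl fun b _ => ?_
  ring

lemma bracketCoord_swap (c : ι) (p q : ι → ℝ) :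
    bracketCoord t c p q = - bracketCoord t c q p := by
  rw [bracketCoord_eq_repr, bracketCoord_eq_repr, ← lie_skew (∑ a, p a • t a),
    map_neg, Finsupp.neg_apply]

lemma bracketCoord_add_right (c : ι) (p q r : ι → ℝ) :
    bracketCoord t c p (fun b => q b + r b) = bracketCoord t c p q + bracketCoord t c p r := by
  simp only [bracketCoord, mul_add, Finset.sum_add_distrib]

lemma bracketCoord_sub_right (c : ι) (p q r : ι → ℝ) :
    bracketCoord t c p (fun b => q b - r b) = bracketCoord t c p q - bracketCoord t c p r := by
  simp only [bracketCoord, mul_sub, Finset.sum_sub_distrib]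

lemma bracketCoord_smul_right (c : ι) (p q : ι → ℝ) (s : ℝ) :
    bracketCoord t c p (fun b => s * q b) = s * bracketCoord t c p q := by
  simp only [bracketCoord, Finset.mul_sum]
  refine Finset.sum_congr rfl fun a _ => Finset.sum_congr rfl fun b _ => by ring

lemma bracketCoord_zero_right (c : ι) (p : ι → ℝ) :
    bracketCoord t c p (fun _ => 0) = 0 := by
  simp [bracketCoord]

lemma bracketCoord_add_left (c : ι) (p q r : ι → ℝ) :
    bracketCoord t c (fun b => p b + q b) r = bracketCoord t c p r + bracketCoord t c q r := by
  simp only [bracketCoord, mul_add, add_mul, Finset.sum_add_distrib]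

lemma bracketCoord_smul_left (c : ι) (p q : ι → ℝ) (s : ℝ) :
    bracketCoord t c (fun b => s * p b) q = s * bracketCoord t c p q := by
  simp only [bracketCoord, Finset.mul_sum]
  refine Finset.sum_congr rfl fun a _ => Finset.sum_congr rfl fun b _ => by ring

/-- The Jacobi identity of `𝔤` read off in components; it removes the terms cubic in `A` from the
Bianchi identity. -/
lemma bracketCoord_jacobi (c : ι) (p q r : ι → ℝ) :
    bracketCoord t c p (fun b => bracketCoord t b q r)
      + bracketCoord t c q (fun b => bracketCoord t b r p)
      + bracketCoord t c r (fun b => bracketCoord t b p q) = 0 := by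
  have h : ∀ p q r : ι → ℝ, bracketCoord t c p (fun b => bracketCoord t b q r)
      = t.repr ⁅∑ a, p a • t a, ⁅∑ a, q a • t a, ∑ a, r a • t a⁆⁆ c := by
    intro p q r
    rw [bracketCoord_eq_repr]
    simp only [bracketCoord_eq_repr t _ q r, t.sum_repr]
  rw [h, h, h, ← Finsupp.add_apply, ← Finsupp.add_apply, ← map_add, ← map_add, lie_jacobi]
  simp

/-! ### The field strength as a tensor -/

variable {A : ι → Π x : M, TangentSpace (𝓡 d) x →L[ℝ] ℝ} (hA : ∀ a, SmoothOneForm (A a))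

lemma fieldStrength_eq_formDeriv_extendVec (c : ι) (x : M) (u v : TangentSpace (𝓡 d) x) :
    fieldStrength t A c x u v = formDeriv (A c) (extendVec u) (extendVec v) x
      + bracketCoord t c (fun a => A a x u) (fun b => A b x v) := by
  simp only [fieldStrength, formDeriv, bracketCoord, extendVec_self]

lemma fieldStrength_swap (c : ι) (x : M) (u v : TangentSpace (𝓡 d) x) :
    fieldStrength t A c x u v = - fieldStrength t A c x v u := by
  rw [fieldStrength_eq_formDeriv_extendVec, fieldStrength_eq_formDeriv_extendVec,
    bracketCoord_swap, formDeriv, formDeriv, mlieBracket_swap_apply, map_neg]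
  ring

include hA

/-- The definition of the field strength at `y` uses the preferred chart at `y`, which may change
with `y`. This version allows fixed fields near `x`, as needed to differentiate the field strength.
-/
lemma fieldStrength_eq_formDeriv (c : ι) (x : M) {X Y : Π x : M, TangentSpace (𝓡 d) x}
    (hX : DiffFieldAt X x) (hY : DiffFieldAt Y x) :
    fieldStrength t A c x (X x) (Y x) = formDeriv (A c) X Y x
      + bracketCoord t c (fun a => A a x (X x)) (fun b => A b x (Y x)) := by
  obtain ⟨B, hB⟩ := formDeriv_bilin (hA c) x
  rw [fieldStrength_eq_formDeriv_extendVec, hB _ _ hX hY,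
    hB _ _ (diffFieldAt_extendVec _) (diffFieldAt_extendVec _), extendVec_self, extendVec_self]

/-- The field strength at a point as a bilinear map. -/
noncomputable def fieldForm (c : ι) (x : M) :
    TangentSpace (𝓡 d) x →ₗ[ℝ] TangentSpace (𝓡 d) x →ₗ[ℝ] ℝ := by
  have h : ∃ B : TangentSpace (𝓡 d) x →L[ℝ] TangentSpace (𝓡 d) x →L[ℝ] ℝ, ∀ u v,
      fieldStrength t A c x u v
        = B u v + bracketCoord t c (fun a => A a x u) (fun b => A b x v) := by
    obtain ⟨B, hB⟩ := formDeriv_bilin (hA c) x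
    refine ⟨B, fun u v => ?_⟩
    rw [fieldStrength_eq_formDeriv_extendVec,
      hB _ _ (diffFieldAt_extendVec _) (diffFieldAt_extendVec _), extendVec_self, extendVec_self]
  refine LinearMap.mk₂ ℝ (fieldStrength t A c x) ?_ ?_ ?_ ?_ <;> obtain ⟨B, hB⟩ := h <;>
    intros <;> simp only [hB, map_add, map_smul, _root_.add_apply, _root_.smul_apply, smul_eq_mul,
      bracketCoord_add_left, bracketCoord_add_right, bracketCoord_smul_left,
      bracketCoord_smul_right] <;> ring

lemma fieldForm_apply (c : ι) (x : M) (u v : TangentSpace (𝓡 d) x) :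
    fieldForm t hA c x u v = fieldStrength t A c x u v := rfl

lemma contMDiffAt_potential_extendVec (c : ι) {x : M} (v : TangentSpace (𝓡 d) x) :
    ContMDiffAt (𝓡 d) 𝓘(ℝ, ℝ) ∞ (fun y => A c y (extendVec v y)) x :=
  (hA c).contMDiffAt_apply (contMDiffAt_extendVec v)

/-- The field strength in coordinates. -/
lemma fieldStrength_extendVec_eventuallyEq (c : ι) {x : M} (u v : TangentSpace (𝓡 d) x) :
    (fun y => fieldStrength t A c y (extendVec u y) (extendVec v y)) =ᶠ[nhds x] fun y =>
      dirDeriv (fun z => A c z (extendVec v z)) y (extendVec u y)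
        - dirDeriv (fun z => A c z (extendVec u z)) y (extendVec v y)
        + ∑ a, ∑ b, structConst t c a b * A a y (extendVec u y) * A b y (extendVec v y) := by
  filter_upwards [eventually_mem_chart_source d x, eventually_diffFieldAt_extendVec u,
    eventually_diffFieldAt_extendVec v] with y hy hu hv
  rw [fieldStrength_eq_formDeriv t hA c y hu hv, formDeriv, mlieBracket_extendVec u v hy, map_zero,
    sub_zero, bracketCoord]

lemma diffFunAt_fieldStrength_extendVec (c : ι) {x : M} (u v : TangentSpace (𝓡 d) x) :
    DiffFunAt d (fun y => fieldStrength t A c y (extendVec u y) (extendVec v y)) x := by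
  have hd : ∀ u v : TangentSpace (𝓡 d) x,
      DiffFunAt d (fun y => dirDeriv (fun z => A c z (extendVec v z)) y (extendVec u y)) x :=
    fun u v => (contMDiffAt_dirDeriv_extendVec (contMDiffAt_potential_extendVec hA c v)
      u).mdifferentiableAt (by simp)
  have ha : ∀ a, ∀ v : TangentSpace (𝓡 d) x, DiffFunAt d (fun y => A a y (extendVec v y)) x :=
    fun a v => (contMDiffAt_potential_extendVec hA a v).mdifferentiableAt (by simp)
  refine MDifferentiableAt.congr_of_eventuallyEq (f := _) ?_
    (fieldStrength_extendVec_eventuallyEq t hA c u v)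
  refine ((hd u v).sub (hd v u)).add ?_
  refine (dirDeriv_sum _ (fun a => (dirDeriv_sum _ (fun b => ?_) 0).1) 0).1
  exact (DiffFunAt.fun_mul mdifferentiableAt_const (ha a u)).fun_mul (ha b v)

/-- Bilinearity reduces to coordinate fields, where the explicit formula is visibly differentiable.
-/
lemma diffFunAt_fieldStrength (c : ι) {x : M} {Y W : Π x : M, TangentSpace (𝓡 d) x}
    (hY : DiffFieldAt Y x) (hW : DiffFieldAt W x) :
    DiffFunAt d (fun y => fieldStrength t A c y (Y y) (W y)) x := by
  obtain ⟨p, hp, hYp⟩ := hY.exists_coeff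
  obtain ⟨q, hq, hWq⟩ := hW.exists_coeff
  have h : (fun y => fieldStrength t A c y (Y y) (W y)) =ᶠ[nhds x] fun y => ∑ i, ∑ j,
      p i y * q j y * fieldStrength t A c y (extendVec (coordVec x i) y)
        (extendVec (coordVec x j) y) := by
    filter_upwards [hYp, hWq] with y h1 h2
    simp only [← fieldForm_apply t hA]
    rw [h1, h2]
    simp only [map_sum, map_smul, LinearMap.sum_apply, LinearMap.smul_apply, smul_eq_mul,
      Finset.mul_sum]
    rw [Finset.sum_comm]
    refine Finset.sum_congr rfl fun i _ => Finset.sum_congr rfl fun j _ => ?_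
    ring
  refine MDifferentiableAt.congr_of_eventuallyEq ?_ h
  refine (dirDeriv_sum _ (fun i => (dirDeriv_sum _ (fun j => ?_) 0).1) 0).1
  exact ((hp i).fun_mul (hq j)).fun_mul (diffFunAt_fieldStrength_extendVec t hA c _ _)

/-! ### The gauge covariant derivative -/

variable (g : LorentzianMetric d M)

omit hA in
lemma gaugeDeriv_def (c : ι) (x : M) (u v w : TangentSpace (𝓡 d) x) :
    gaugeDeriv t g A c x u v w =
      dirDeriv (fun y => fieldStrength t A c y (extendVec v y) (extendVec w y)) x u
        - fieldStrength t A c x (g.nabla x u (extendVec v)) w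
        - fieldStrength t A c x v (g.nabla x u (extendVec w))
        + bracketCoord t c (fun a => A a x u) (fun b => fieldStrength t A b x v w) := rfl

/-- The gauge covariant derivative of the field strength evaluated on two vector fields. -/
noncomputable def gaugeDerivField (A : ι → Π x : M, TangentSpace (𝓡 d) x →L[ℝ] ℝ) (c : ι) (x : M)
    (u : TangentSpace (𝓡 d) x) (Y W : Π x : M, TangentSpace (𝓡 d) x) : ℝ :=
  dirDeriv (fun y => fieldStrength t A c y (Y y) (W y)) x u
    - fieldStrength t A c x (g.nabla x u Y) (W x)
    - fieldStrength t A c x (Y x) (g.nabla x u W)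
    + bracketCoord t c (fun a => A a x u) (fun b => fieldStrength t A b x (Y x) (W x))

omit hA in
lemma gaugeDerivField_swap (c : ι) (x : M) (u : TangentSpace (𝓡 d) x)
    (Y W : Π x : M, TangentSpace (𝓡 d) x) :
    gaugeDerivField t g A c x u Y W = -gaugeDerivField t g A c x u W Y := by
  have h1 : (fun y => fieldStrength t A c y (Y y) (W y))
      = fun y => 0 - fieldStrength t A c y (W y) (Y y) :=
    funext fun y => by rw [fieldStrength_swap, zero_sub]
  have h2 : (fun b => fieldStrength t A b x (Y x) (W x))
      = fun b => 0 - fieldStrength t A b x (W x) (Y x) :=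
    funext fun b => by rw [fieldStrength_swap, zero_sub]
  have h3 : dirDeriv (fun y => 0 - fieldStrength t A c y (W y) (Y y)) x u
      = -dirDeriv (fun y => fieldStrength t A c y (W y) (Y y)) x u := by
    simp [dirDeriv, mvfderiv_fun_neg]
  simp only [gaugeDerivField, h1, h2, h3, bracketCoord_sub_right, bracketCoord_zero_right]
  rw [fieldStrength_swap t c x _ (W x), fieldStrength_swap t c x (Y x)]
  ring

/-- Differentiating the scalar factor in `F(fY, W)` produces a term that the Leibniz rule for `∇_u
(fY)` subtracts again. -/
lemma gaugeDerivField_tensorialAt_left (c : ι) (x : M) (u : TangentSpace (𝓡 d) x)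
    {W : Π x : M, TangentSpace (𝓡 d) x} (hW : DiffFieldAt W x) :
    TensorialAt (𝓡 d) (EuclideanSpace ℝ (Fin d)) (fun Y => gaugeDerivField t g A c x u Y W) x where
  smul := by
    intro f Y hf hY
    simp only [gaugeDerivField, g.nabla_smul u hf hY, ← fieldForm_apply t hA, Pi.smul_apply',
      map_smul, map_add, LinearMap.smul_apply, LinearMap.add_apply, smul_eq_mul,
      bracketCoord_smul_right]
    have h : DiffFunAt d (fun y => fieldForm t hA c y (Y y) (W y)) x :=
      diffFunAt_fieldStrength t hA c hY hW
    rw [dirDeriv_mul hf h]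
    ring
  add := by
    intro Y Y' hY hY'
    simp only [gaugeDerivField, g.nabla_add u hY hY', ← fieldForm_apply t hA, Pi.add_apply,
      map_add, LinearMap.add_apply, bracketCoord_add_right]
    have h : ∀ Y, DiffFieldAt Y x → DiffFunAt d (fun y => fieldForm t hA c y (Y y) (W y)) x :=
      fun Y hY => diffFunAt_fieldStrength t hA c hY hW
    rw [dirDeriv_add (h Y hY) (h Y' hY')]
    ring

lemma gaugeDerivField_tensorialAt_right (c : ι) (x : M) (u : TangentSpace (𝓡 d) x)
    {Y : Π x : M, TangentSpace (𝓡 d) x} (hY : DiffFieldAt Y x) :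
    TensorialAt (𝓡 d) (EuclideanSpace ℝ (Fin d)) (fun W => gaugeDerivField t g A c x u Y W) x where
  smul := by
    intro f W hf hW
    rw [gaugeDerivField_swap, gaugeDerivField_swap t g c x u Y W,
      (gaugeDerivField_tensorialAt_left t hA g c x u hY).smul hf hW, smul_eq_mul, smul_eq_mul]
    ring
  add := by
    intro W W' hW hW'
    rw [gaugeDerivField_swap, gaugeDerivField_swap t g c x u Y W,
      gaugeDerivField_swap t g c x u Y W',
      (gaugeDerivField_tensorialAt_left t hA g c x u hY).add hW hW']
    ring

/-- Permits computing `𝒟F` with the field `ℓ` itself in place of the chart extension of its value.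
-/
lemma gaugeDeriv_eq_gaugeDerivField (c : ι) (x : M) (u : TangentSpace (𝓡 d) x)
    {Y W : Π x : M, TangentSpace (𝓡 d) x} (hY : DiffFieldAt Y x) (hW : DiffFieldAt W x) :
    gaugeDeriv t g A c x u (Y x) (W x) = gaugeDerivField t g A c x u Y W := by
  rw [← TensorialAt.pointwise₂ (Φ := gaugeDerivField t g A c x u)
    (fun _ h => gaugeDerivField_tensorialAt_left t hA g c x u h)
    (fun _ h => gaugeDerivField_tensorialAt_right t hA g c x u h)
    (diffFieldAt_extendVec (Y x)) hY (diffFieldAt_extendVec (W x)) hW (extendVec_self _)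
    (extendVec_self _)]
  simp only [gaugeDeriv_def, gaugeDerivField, extendVec_self]

/-- The gauge covariant derivative as a bilinear form in its first two arguments. -/
noncomputable def gaugeForm (c : ι) (x : M) (w : TangentSpace (𝓡 d) x) :
    TangentSpace (𝓡 d) x →ₗ[ℝ] TangentSpace (𝓡 d) x →ₗ[ℝ] ℝ := by
  have h : ∀ u, ∃ k : TangentSpace (𝓡 d) x →L[ℝ] ℝ, ∀ v, gaugeDeriv t g A c x u v w = k v := by
    intro u
    have ht := gaugeDerivField_tensorialAt_left t hA g c x u (diffFieldAt_extendVec w)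
    refine ⟨TensorialAt.mkHom _ x ht, fun v => ?_⟩
    rw [TensorialAt.mkHom_apply_eq_extend]
    have h1 := gaugeDeriv_eq_gaugeDerivField t hA g c x u (diffFieldAt_extendVec v)
      (diffFieldAt_extendVec w)
    rwa [extendVec_self, extendVec_self] at h1
  refine LinearMap.mk₂ ℝ (fun u v => gaugeDeriv t g A c x u v w) ?_ ?_ ?_ ?_
  · intro u u' v
    simp only [gaugeDeriv_def, g.nabla_vec_add u u' (diffFieldAt_extendVec _), dirDeriv_vec_add,
      ← fieldForm_apply t hA, map_add, LinearMap.add_apply, bracketCoord_add_left]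
    ring
  · intro s u v
    simp only [gaugeDeriv_def, g.nabla_vec_smul s u (diffFieldAt_extendVec _), dirDeriv_vec_smul,
      ← fieldForm_apply t hA, map_smul, LinearMap.smul_apply, bracketCoord_smul_left, smul_eq_mul]
    ring
  · intro u v v'
    obtain ⟨k, hk⟩ := h u
    simp only [hk, map_add]
  · intro s u v
    obtain ⟨k, hk⟩ := h u
    simp only [hk, map_smul]

lemma gaugeForm_apply (c : ι) (x : M) (u v w : TangentSpace (𝓡 d) x) :
    gaugeForm t hA g c x w u v = gaugeDeriv t g A c x u v w := rfl

omit hA in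
lemma gaugeDeriv_swap (c : ι) (x : M) (u v w : TangentSpace (𝓡 d) x) :
    gaugeDeriv t g A c x u v w = - gaugeDeriv t g A c x u w v := by
  have h := gaugeDerivField_swap (A := A) t g c x u (extendVec v) (extendVec w)
  simp only [gaugeDerivField, extendVec_self] at h
  rw [gaugeDeriv_def, gaugeDeriv_def]
  linarith

/-- The Bianchi identity. -/
lemma bianchi (c : ι) (x : M) (u v w : TangentSpace (𝓡 d) x) :
    gaugeDeriv t g A c x u v w + gaugeDeriv t g A c x v w u + gaugeDeriv t g A c x w u v = 0 := by
  -- In coordinates, `S u v w` is `∂_u ∂_v A_w`, `P u v` is `∂_u A_v` and `p u` is `A_u`. After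
  -- expansion the identity is polynomial in these and in the connection terms.
  let S : TangentSpace (𝓡 d) x → TangentSpace (𝓡 d) x → TangentSpace (𝓡 d) x → ℝ := fun u v w =>
    dirDeriv (fun y => dirDeriv (fun z => A c z (extendVec w z)) y (extendVec v y)) x u
  let P : TangentSpace (𝓡 d) x → TangentSpace (𝓡 d) x → ι → ℝ := fun u v a =>
    dirDeriv (fun z => A a z (extendVec v z)) x u
  let p : TangentSpace (𝓡 d) x → ι → ℝ := fun u a => A a x u
  have hS : ∀ u v w, S u v w = S v u w := fun u v w =>
    dirDeriv_dirDeriv_extendVec_comm (contMDiffAt_potential_extendVec hA c w) u v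
  have hF : ∀ v w : TangentSpace (𝓡 d) x, (fun b => fieldStrength t A b x v w)
      = fun b => (P v w b - P w v b) + bracketCoord t b (p v) (p w) := by
    intro v w
    funext b
    have h := (fieldStrength_extendVec_eventuallyEq t hA b v w).eq_of_nhds
    simp only [extendVec_self] at h
    exact h
  have hd : ∀ u v : TangentSpace (𝓡 d) x,
      DiffFunAt d (fun y => dirDeriv (fun z => A c z (extendVec v z)) y (extendVec u y)) x :=
    fun u v => (contMDiffAt_dirDeriv_extendVec (contMDiffAt_potential_extendVec hA c v)
      u).mdifferentiableAt (by simp)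
  have ha : ∀ a, ∀ v : TangentSpace (𝓡 d) x, DiffFunAt d (fun y => A a y (extendVec v y)) x :=
    fun a v => (contMDiffAt_potential_extendVec hA a v).mdifferentiableAt (by simp)
  have hdF : ∀ u v w, dirDeriv (fun y => fieldStrength t A c y (extendVec v y) (extendVec w y)) x u
      = S u v w - S u w v + bracketCoord t c (P u v) (p w) + bracketCoord t c (p v) (P u w) := by
    intro u v w
    have hm : ∀ a b, DiffFunAt d (fun y =>
        structConst t c a b * A a y (extendVec v y) * A b y (extendVec w y)) x := fun a b =>
      (DiffFunAt.fun_mul mdifferentiableAt_const (ha a v)).fun_mul (ha b w)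
    have hs : ∀ a, DiffFunAt d (fun y => ∑ b,
        structConst t c a b * A a y (extendVec v y) * A b y (extendVec w y)) x := fun a =>
      (dirDeriv_sum _ (hm a) 0).1
    have hsub : DiffFunAt d (fun y => dirDeriv (fun z => A c z (extendVec w z)) y (extendVec v y)
        - dirDeriv (fun z => A c z (extendVec v z)) y (extendVec w y)) x := (hd v w).sub (hd w v)
    rw [dirDeriv_congr (fieldStrength_extendVec_eventuallyEq t hA c v w),
      dirDeriv_add hsub (dirDeriv_sum _ hs 0).1, dirDeriv_sub (hd v w) (hd w v),
      (dirDeriv_sum _ hs u).2]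
    have h1 : ∀ a b, dirDeriv (fun y =>
        structConst t c a b * A a y (extendVec v y) * A b y (extendVec w y)) x u
        = structConst t c a b * P u v a * p w b + structConst t c a b * p v a * P u w b := by
      intro a b
      rw [dirDeriv_mul (DiffFunAt.fun_mul mdifferentiableAt_const (ha a v)) (ha b w),
        dirDeriv_mul mdifferentiableAt_const (ha a v), dirDeriv_const]
      simp only [extendVec_self, P, p]
      ring
    simp only [(dirDeriv_sum _ (hm _) u).2, h1, Finset.sum_add_distrib]
    simp only [bracketCoord, S, P, p]
    ring
  simp only [gaugeDeriv_def, hdF, hF, bracketCoord_add_right, bracketCoord_sub_right]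
  -- The connection terms cancel in pairs by absence of torsion. The second derivatives then cancel
  -- by commutation, the terms in `A ∂A` by skewness of the bracket, and the cubic terms by Jacobi.
  rw [g.nabla_extendVec_symm v u, g.nabla_extendVec_symm w v, g.nabla_extendVec_symm w u]
  have e1 := fieldStrength_swap (A := A) t c x
  have e2 := bracketCoord_jacobi t c (p u) (p v) (p w)
  have e3 := bracketCoord_swap t c
  have e4 := e1 v (g.nabla x u (extendVec w))
  have e5 := e1 w (g.nabla x u (extendVec v))
  have e6 := e1 u (g.nabla x v (extendVec w))
  rw [hS v u w, hS w v u, hS w u v, e3 (P u v), e3 (P v w), e3 (P w u)]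
  have e7 := e3 (p v) (P u w)
  have e8 := e3 (p w) (P v u)
  have e9 := e3 (p u) (P w v)
  simp only [p] at *
  linarith

end Gauge

/-! ### Null frames -/

namespace LorentzianMetric

variable {g : LorentzianMetric d M}

/-- Expansion of a tangent vector in a null frame. -/
lemma IsNullFrame.eq_expansion (hd : 2 ≤ d) {x : M} {l n : TangentSpace (𝓡 d) x}
    {m : Fin (d - 2) → TangentSpace (𝓡 d) x} (h : g.IsNullFrame x l n m)
    (v : TangentSpace (𝓡 d) x) :
    v = g.val x v n • l + g.val x v l • n + ∑ i, g.val x v (m i) • m i := by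
  have hnl : g.val x n l = 1 := by rw [g.symm, h.l_n]
  have hml : ∀ i, g.val x (m i) l = 0 := fun i => by rw [g.symm, h.l_m]
  have hmn : ∀ i, g.val x (m i) n = 0 := fun i => by rw [g.symm, h.n_m]
  -- The metric pairings recover the coefficients, so this synthesis map is injective; since `2 + (d
  -- - 2) = d`, it is also surjective. The coefficient of `ℓ` is the pairing with `n`, and
  -- conversely.
  let Φ : (ℝ × ℝ) × (Fin (d - 2) → ℝ) →ₗ[ℝ] TangentSpace (𝓡 d) x :=
    { toFun := fun p => p.1.1 • l + p.1.2 • n + ∑ i, p.2 i • m i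
      map_add' := fun p q => by
        simp only [Prod.fst_add, Prod.snd_add, Pi.add_apply, add_smul, Finset.sum_add_distrib]
        abel
      map_smul' := fun c p => by
        simp only [Prod.smul_fst, Prod.smul_snd, Pi.smul_apply, smul_eq_mul, mul_smul, smul_add,
          Finset.smul_sum, RingHom.id_apply] }
  have hΦ : ∀ p, Φ p = p.1.1 • l + p.1.2 • n + ∑ i, p.2 i • m i := fun _ => rfl
  have hn : ∀ p, g.val x (Φ p) n = p.1.1 := fun p => by
    simp [hΦ, h.l_n, h.n_n, hmn]
  have hl : ∀ p, g.val x (Φ p) l = p.1.2 := fun p => by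
    simp [hΦ, h.l_l, hnl, hml]
  have hm : ∀ p i, g.val x (Φ p) (m i) = p.2 i := fun p i => by
    simp [hΦ, h.l_m, h.n_m, h.m_m]
  have hinj : Function.Injective Φ := by
    intro p q hpq
    refine Prod.ext (Prod.ext ?_ ?_) (funext fun i => ?_)
    · rw [← hn p, ← hn q, hpq]
    · rw [← hl p, ← hl q, hpq]
    · rw [← hm p, ← hm q, hpq]
  have hfin : Module.finrank ℝ (TangentSpace (𝓡 d) x) = d :=
    finrank_euclideanSpace_fin (𝕜 := ℝ) (n := d)
  have : FiniteDimensional ℝ (TangentSpace (𝓡 d) x) :=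
    inferInstanceAs (FiniteDimensional ℝ (EuclideanSpace ℝ (Fin d)))
  have hsurj := (LinearMap.injective_iff_surjective_of_finrank_eq_finrank (f := Φ) (by
    rw [hfin]
    simp
    omega)).1 hinj
  obtain ⟨p, rfl⟩ := hsurj v
  simp only [hn, hl, hm]
  exact hΦ p

/-- Contraction of a bilinear form with the inverse metric, computed in a null frame. -/
lemma IsNullFrame.sum_gramInv (hd : 2 ≤ d) {x : M} {l n : TangentSpace (𝓡 d) x}
    {m : Fin (d - 2) → TangentSpace (𝓡 d) x} (h : g.IsNullFrame x l n m)
    (B : TangentSpace (𝓡 d) x →ₗ[ℝ] TangentSpace (𝓡 d) x →ₗ[ℝ] ℝ) :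
    ∑ μ, ∑ ν, g.gramInv x μ ν * B (coordVec x ν) (coordVec x μ)
      = B l n + B n l + ∑ i, B (m i) (m i) := by
  -- Lowering and then raising an index is the identity. Expanding one slot of `B` in the null frame
  -- leaves sums of this shape.
  have h1 : ∀ a b : TangentSpace (𝓡 d) x,
      ∑ μ, ∑ ν, g.gramInv x μ ν * g.val x (coordVec x ν) a * B b (coordVec x μ) = B b a := by
    intro a b
    conv_rhs => rw [← g.raise_lower a]
    simp only [map_sum, map_smul, smul_eq_mul]
  have h2 : ∀ μ ν, g.gramInv x μ ν * B (coordVec x ν) (coordVec x μ)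
      = g.gramInv x μ ν * g.val x (coordVec x ν) n * B l (coordVec x μ)
        + g.gramInv x μ ν * g.val x (coordVec x ν) l * B n (coordVec x μ)
        + ∑ i, g.gramInv x μ ν * g.val x (coordVec x ν) (m i) * B (m i) (coordVec x μ) := by
    intro μ ν
    conv_lhs => rw [h.eq_expansion hd (coordVec x ν)]
    simp only [map_add, map_smul, map_sum, LinearMap.add_apply, LinearMap.smul_apply,
      LinearMap.sum_apply, smul_eq_mul, mul_add, Finset.mul_sum, mul_assoc]
  simp only [h2, Finset.sum_add_distrib, h1]
  congr 1
  rw [Finset.sum_congr rfl fun μ _ => Finset.sum_comm, Finset.sum_comm]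
  exact Finset.sum_congr rfl fun i _ => h1 _ _

end LorentzianMetric

/-! ### Null aligned fields -/

section Null

variable {𝔤 : Type*} [LieRing 𝔤] [LieAlgebra ℝ 𝔤] {ι : Type*} [Fintype ι]
  {t : Module.Basis ι ℝ 𝔤} {A : ι → Π x : M, TangentSpace (𝓡 d) x →L[ℝ] ℝ}
  {g : LorentzianMetric d M} {l : Π x : M, TangentSpace (𝓡 d) x}

/-- Only `F(n, m_i)` survives in the adapted frame, so `φ` is the covector `∑ F(n, m_i) g(m_i, ·)`.
The resulting form does not mention the frame, so its consequences hold in every null frame starting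
with `ℓ`. -/
lemma IsNullAligned.exists_eq_wedge (hnull : IsNullAligned t g A l) (hd : 2 ≤ d)
    (hA : ∀ a, SmoothOneForm (A a)) (c : ι) (x : M) :
    ∃ φ : TangentSpace (𝓡 d) x → ℝ, φ (l x) = 0 ∧ ∀ u v, fieldStrength t A c x u v
      = g.val x (l x) u * φ v - g.val x (l x) v * φ u := by
  obtain ⟨n, m, h, hF⟩ := hnull x
  obtain ⟨h0i, h01, hij⟩ := hF c
  have hi0 : ∀ i, fieldStrength t A c x (m i) (l x) = 0 := fun i => by
    rw [fieldStrength_swap, h0i, neg_zero]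
  have h10 : fieldStrength t A c x n (l x) = 0 := by rw [fieldStrength_swap, h01, neg_zero]
  have hself : ∀ u, fieldStrength t A c x u u = 0 := fun u => by
    have := fieldStrength_swap (A := A) t c x u u
    linarith
  have hi1 : ∀ i, fieldStrength t A c x (m i) n = -fieldStrength t A c x n (m i) :=
    fun i => fieldStrength_swap t c x _ _
  refine ⟨fun v => ∑ i, g.val x v (m i) * fieldStrength t A c x n (m i), by simp [h.l_m], ?_⟩
  simp only [← fieldForm_apply t hA] at *
  have hF : ∀ (w v : TangentSpace (𝓡 d) x), fieldForm t hA c x w v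
      = g.val x v n * fieldForm t hA c x w (l x) + g.val x v (l x) * fieldForm t hA c x w n
        + ∑ i, g.val x v (m i) * fieldForm t hA c x w (m i) := by
    intro w v
    conv_lhs => rw [h.eq_expansion hd v]
    simp only [map_add, map_smul, map_sum, smul_eq_mul]
  have hlF : ∀ v, fieldForm t hA c x (l x) v = 0 := fun v => by
    rw [hF]
    simp [hself, h01, h0i]
  have hnF : ∀ v, fieldForm t hA c x n v
      = ∑ i, g.val x v (m i) * fieldForm t hA c x n (m i) := fun v => by
    rw [hF]
    simp [hself, h10]
  have hmF : ∀ i v, fieldForm t hA c x (m i) v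
      = -(g.val x v (l x) * fieldForm t hA c x n (m i)) := fun i v => by
    rw [hF]
    simp [hi0, hi1, hij]
  intro u v
  conv_lhs => rw [h.eq_expansion hd u]
  simp only [map_add, map_smul, map_sum, LinearMap.add_apply, LinearMap.smul_apply,
    LinearMap.sum_apply, smul_eq_mul, hlF, hmF, hnF v, g.symm x (l x)]
  rw [mul_zero, zero_add, sub_eq_add_neg, Finset.mul_sum _ _ (g.val x v (l x)),
    ← Finset.sum_neg_distrib]
  congr 1
  refine Finset.sum_congr rfl fun i _ => ?_
  ring

lemma IsNullAligned.val_self (hnull : IsNullAligned t g A l) (x : M) :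
    g.val x (l x) (l x) = 0 := by
  obtain ⟨n, m, h, -⟩ := hnull x
  exact h.l_l

lemma IsNullAligned.val_nabla_self (hnull : IsNullAligned t g A l) (hl : SmoothVectorField l)
    (x : M) (κ : TangentSpace (𝓡 d) x) : g.val x (g.nabla x κ l) (l x) = 0 := by
  have h := g.dirDeriv_val κ (hl.diffFieldAt x) (hl.diffFieldAt x)
  rw [show (fun y => g.val y (l y) (l y)) = fun _ => 0 from funext hnull.val_self,
    dirDeriv_const, g.symm x (l x)] at h
  linarith

variable (hd : 2 ≤ d) (hA : ∀ a, SmoothOneForm (A a)) (hnull : IsNullAligned t g A l)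

include hd hA hnull

lemma IsNullAligned.fieldStrength_left (c : ι) (x : M) (v : TangentSpace (𝓡 d) x) :
    fieldStrength t A c x (l x) v = 0 := by
  obtain ⟨φ, hφ, hF⟩ := hnull.exists_eq_wedge hd hA c x
  rw [hF, hφ, hnull.val_self]
  ring

/-- This is `ℓ♭ ∧ F = 0`. Unlike the factor `φ`, which is chosen point by point without any
regularity, this identity contains only differentiable tensors and can be differentiated. -/
lemma IsNullAligned.fieldStrength_cyclic (c : ι) (x : M) (u v w : TangentSpace (𝓡 d) x) :
    g.val x (l x) u * fieldStrength t A c x v w + g.val x (l x) v * fieldStrength t A c x w u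
      + g.val x (l x) w * fieldStrength t A c x u v = 0 := by
  obtain ⟨φ, hφ, hF⟩ := hnull.exists_eq_wedge hd hA c x
  simp only [hF]
  ring

/-! ### Derivatives of the null condition and components in an arbitrary adapted frame -/

variable (hl : SmoothVectorField l)

include hl

/-- The Leibniz rule applied to `F(ℓ, ·) = 0`. -/
lemma IsNullAligned.gaugeDeriv_left (c : ι) (x : M) (κ w : TangentSpace (𝓡 d) x) :
    gaugeDeriv t g A c x κ (l x) w = -fieldStrength t A c x (g.nabla x κ l) w := by
  have h := gaugeDeriv_eq_gaugeDerivField t hA g c x κ (hl.diffFieldAt x)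
    (diffFieldAt_extendVec w)
  rw [extendVec_self] at h
  rw [h, gaugeDerivField]
  simp only [hnull.fieldStrength_left hd hA, dirDeriv_const, bracketCoord_zero_right,
    extendVec_self]
  ring

variable {x : M} {n : TangentSpace (𝓡 d) x} {m : Fin (d - 2) → TangentSpace (𝓡 d) x}
  (hfr : g.IsNullFrame x (l x) n m)

include hfr

omit hl in
lemma IsNullAligned.fieldStrength_m_m (c : ι) (i j : Fin (d - 2)) :
    fieldStrength t A c x (m i) (m j) = 0 := by
  have h := hnull.fieldStrength_cyclic hd hA c x n (m i) (m j)
  rw [hfr.l_n, hfr.l_m, hfr.l_m] at h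
  linarith

omit hl in
lemma IsNullAligned.fieldStrength_m (c : ι) (u : TangentSpace (𝓡 d) x) (j : Fin (d - 2)) :
    fieldStrength t A c x u (m j) = g.val x (l x) u * phiPrime t A c x n m j := by
  have h := hnull.fieldStrength_cyclic hd hA c x n u (m j)
  rw [hfr.l_n, hfr.l_m, fieldStrength_swap t c x (m j) n] at h
  rw [phiPrime]
  linarith

omit hl in
lemma IsNullAligned.fieldStrength_n (c : ι) (u : TangentSpace (𝓡 d) x) :
    fieldStrength t A c x u n = -∑ i, g.val x u (m i) * phiPrime t A c x n m i := by
  have hnn : fieldStrength t A c x n n = 0 := by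
    have := fieldStrength_swap (A := A) t c x n n
    linarith
  have h1 := hnull.fieldStrength_left hd hA c x n
  have h2 : ∀ i, fieldStrength t A c x (m i) n = -phiPrime t A c x n m i :=
    fun i => fieldStrength_swap t c x _ _
  rw [← fieldForm_apply t hA] at hnn h1 ⊢
  simp only [← fieldForm_apply t hA] at h2
  conv_lhs => rw [hfr.eq_expansion hd u]
  simp [hnn, h1, h2]

/-- The Leibniz rule applied to `ℓ♭ ∧ F = 0` on `(n, m_j, m_k)`. As `g(ℓ, n) = 1` while `g(ℓ, m_j)`,
`g(ℓ, m_k)` and `F(m_j, m_k)` vanish at the point, no derivative of `φ'` survives. -/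
lemma IsNullAligned.gaugeDeriv_m_m (c : ι) (κ : TangentSpace (𝓡 d) x) (j k : Fin (d - 2)) :
    gaugeDeriv t g A c x κ (m j) (m k)
      = g.val x (g.nabla x κ l) (m j) * phiPrime t A c x n m k
        - g.val x (g.nabla x κ l) (m k) * phiPrime t A c x n m j := by
  have dl : ∀ v : TangentSpace (𝓡 d) x, DiffFunAt d (fun y => g.val y (l y) (extendVec v y)) x :=
    fun v => g.diffFunAt_apply (hl.diffFieldAt x) (diffFieldAt_extendVec v)
  have dF : ∀ u v : TangentSpace (𝓡 d) x,
      DiffFunAt d (fun y => fieldStrength t A c y (extendVec u y) (extendVec v y)) x :=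
    fun u v => diffFunAt_fieldStrength_extendVec t hA c u v
  -- The extended vectors need not form a null frame away from `x`; the frame relations are used
  -- only after differentiating, and the derivatives of the extensions cancel against those in `𝒟F`.
  have h0 := congrArg (fun f => dirDeriv f x κ) (funext fun y =>
    hnull.fieldStrength_cyclic hd hA c y (extendVec n y) (extendVec (m j) y) (extendVec (m k) y))
  have d1 := (dl n).fun_mul (dF (m j) (m k))
  have d2 := (dl (m j)).fun_mul (dF (m k) n)
  have d3 := (dl (m k)).fun_mul (dF n (m j))
  simp only [dirDeriv_const, dirDeriv_add (d1.fun_add d2) d3, dirDeriv_add d1 d2,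
    dirDeriv_mul (dl n) (dF (m j) (m k)), dirDeriv_mul (dl (m j)) (dF (m k) n),
    dirDeriv_mul (dl (m k)) (dF n (m j)), extendVec_self, hfr.l_n, hfr.l_m,
    hnull.fieldStrength_m_m hd hA hfr,
    g.dirDeriv_val κ (hl.diffFieldAt x) (diffFieldAt_extendVec (m j)),
    g.dirDeriv_val κ (hl.diffFieldAt x) (diffFieldAt_extendVec (m k)),
    fieldStrength_swap t c x (m k) n] at h0
  have h1 := gaugeDeriv_def (A := A) t g c x κ (m j) (m k)
  simp only [hnull.fieldStrength_m_m hd hA hfr, bracketCoord_zero_right,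
    hnull.fieldStrength_m hd hA hfr, fieldStrength_swap t c x (m j) (g.nabla x κ _)] at h1
  rw [h1]
  simp only [phiPrime] at *
  linarith

/-- `∇_κ ℓ` pairs trivially with `m_j` under the field strength. -/
lemma IsNullAligned.fieldStrength_nabla_m (c : ι) (κ : TangentSpace (𝓡 d) x) (j : Fin (d - 2)) :
    fieldStrength t A c x (g.nabla x κ l) (m j) = 0 := by
  rw [hnull.fieldStrength_m hd hA hfr, g.symm, hnull.val_nabla_self hl, zero_mul]

omit hl in
lemma IsNullAligned.exists_phiPrime_ne_zero (hne : IsNonvanishing t A) :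
    ∃ a, phiPrime t A a x n m ≠ 0 := by
  obtain ⟨c, u, v, huv⟩ := hne x
  refine ⟨c, fun h0 => huv ?_⟩
  have h1 := hnull.fieldStrength_n hd hA hfr c
  have h2 := hnull.fieldStrength_m hd hA hfr c u
  simp only [h0, Pi.zero_apply, mul_zero, Finset.sum_const_zero, neg_zero] at h1 h2
  have h3 : fieldStrength t A c x u (l x) = 0 := by
    rw [fieldStrength_swap, hnull.fieldStrength_left hd hA, neg_zero]
  have h4 := h1 u
  rw [← fieldForm_apply t hA] at h3 h4 ⊢
  simp only [← fieldForm_apply t hA] at h2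
  rw [hfr.eq_expansion hd v]
  simp [h2, h3, h4]

/-! ### The field equation in a null frame, and geodeticity -/

lemma IsNullAligned.yangMills (hYM : IsYangMills t g A) (c : ι) (w : TangentSpace (𝓡 d) x) :
    gaugeDeriv t g A c x (l x) n w + gaugeDeriv t g A c x n (l x) w
      + ∑ i, gaugeDeriv t g A c x (m i) (m i) w = 0 := by
  have h := hfr.sum_gramInv hd (gaugeForm t hA g c x w)
  simp only [gaugeForm_apply] at h
  rw [← h]
  exact hYM c x w

/-- The field equation contracted with `ℓ`: only `𝒟_ℓ F(n, ℓ) = F(∇_ℓ ℓ, n)` survives. -/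
lemma IsNullAligned.sum_nabla_mul_phiPrime (hYM : IsYangMills t g A) (c : ι) :
    ∑ i, g.val x (g.nabla x (l x) l) (m i) * phiPrime t A c x n m i = 0 := by
  have h := hnull.yangMills hd hA hl hfr hYM c (l x)
  have h1 : ∀ v, fieldStrength t A c x v (l x) = 0 := fun v => by
    rw [fieldStrength_swap, hnull.fieldStrength_left hd hA, neg_zero]
  simp only [gaugeDeriv_swap (A := A) t g c x (l x) n, gaugeDeriv_swap (A := A) t g c x (m _) (m _) (l x),
    hnull.gaugeDeriv_left hd hA hl, h1,
    hnull.fieldStrength_nabla_m hd hA hl hfr, hnull.fieldStrength_n hd hA hfr] at h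
  simpa using h

/-- Bianchi on `(ℓ, m_i, m_j)`: the two terms with `ℓ` inside `F` vanish, leaving `𝒟_ℓ F(m_i, m_j) =
0`. -/
lemma IsNullAligned.nabla_mul_phiPrime_comm (c : ι) (i j : Fin (d - 2)) :
    g.val x (g.nabla x (l x) l) (m i) * phiPrime t A c x n m j
      = g.val x (g.nabla x (l x) l) (m j) * phiPrime t A c x n m i := by
  have h := bianchi t hA g c x (l x) (m i) (m j)
  rw [gaugeDeriv_swap t g c x (m i), hnull.gaugeDeriv_left hd hA hl,
    hnull.gaugeDeriv_left hd hA hl, hnull.fieldStrength_nabla_m hd hA hl hfr,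
    hnull.fieldStrength_nabla_m hd hA hl hfr, hnull.gaugeDeriv_m_m hd hA hl hfr] at h
  linarith

lemma IsNullAligned.nabla_self_eq_smul (hYM : IsYangMills t g A) (hne : IsNonvanishing t A) :
    g.nabla x (l x) l = g.val x (g.nabla x (l x) l) n • l x := by
  obtain ⟨c, hc⟩ := hnull.exists_phiPrime_ne_zero hd hA hfr hne
  obtain ⟨j, hj⟩ := Function.ne_iff.1 hc
  have hpos : 0 < ∑ i, phiPrime t A c x n m i * phiPrime t A c x n m i :=
    Finset.sum_pos' (fun i _ => mul_self_nonneg _)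
      ⟨j, Finset.mem_univ j, mul_self_pos.2 hj⟩
  have h0 : ∀ i, g.val x (g.nabla x (l x) l) (m i) = 0 := by
    intro i
    -- Parallelism turns `a_i |φ'|²` into `(a · φ') φ'_i`, which vanishes by orthogonality.
    have h1 : g.val x (g.nabla x (l x) l) (m i)
        * ∑ k, phiPrime t A c x n m k * phiPrime t A c x n m k = 0 := by
      have h2 := congrArg (fun s => s * phiPrime t A c x n m i)
        (hnull.sum_nabla_mul_phiPrime hd hA hl hfr hYM c)
      simp only [zero_mul, Finset.sum_mul] at h2
      rw [Finset.mul_sum, ← h2]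
      refine Finset.sum_congr rfl fun k _ => ?_
      rw [← mul_assoc, hnull.nabla_mul_phiPrime_comm hd hA hl hfr c i k]
      ring
    exact (mul_eq_zero.1 h1).resolve_right hpos.ne'
  conv_lhs => rw [hfr.eq_expansion hd (g.nabla x (l x) l)]
  simp [h0, hnull.val_nabla_self hl]

/-! ### The optical matrix -/

/-- Yang–Mills along `m_j` gives `𝒟_ℓ F(n, m_j) = ∑ ρ_{ji} φ'_i - ρ φ'_j`, and Bianchi on `(ℓ, n,
m_j)` gives `𝒟_ℓ F(n, m_j) = -∑ ρ_{ij} φ'_i`. Equating the two symmetrizes `ρ`. -/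
lemma IsNullAligned.opticalMatrix_symm_mulVec (hYM : IsYangMills t g A) (c : ι)
    (j : Fin (d - 2)) :
    ∑ i, ((g.opticalMatrix l x m j i + g.opticalMatrix l x m i j) / 2) * phiPrime t A c x n m i
      = (g.opticalMatrix l x m).trace / 2 * phiPrime t A c x n m j := by
  have h1 := hnull.yangMills hd hA hl hfr hYM c (m j)
  have h2 := bianchi t hA g c x (l x) n (m j)
  have h3 : ∀ v, fieldStrength t A c x v (l x) = 0 := fun v => by
    rw [fieldStrength_swap, hnull.fieldStrength_left hd hA, neg_zero]
  rw [gaugeDeriv_swap t g c x n, hnull.gaugeDeriv_left hd hA hl,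
    hnull.gaugeDeriv_left hd hA hl, hnull.fieldStrength_nabla_m hd hA hl hfr,
    hnull.fieldStrength_n hd hA hfr] at h2
  simp only [hnull.gaugeDeriv_left hd hA hl, hnull.fieldStrength_nabla_m hd hA hl hfr,
    hnull.gaugeDeriv_m_m hd hA hl hfr, Finset.sum_sub_distrib, ← Finset.sum_mul] at h1
  have h4 : ∀ i k, g.opticalMatrix l x m i k = g.val x (g.nabla x (m k) l) (m i) :=
    fun i k => g.symm x _ _
  simp only [Matrix.trace, Matrix.diag_apply, h4, add_div, add_mul, Finset.sum_add_distrib,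
    div_mul_eq_mul_div, ← Finset.sum_div]
  linarith

/-- Bianchi on `(m_i, m_j, m_k)`, with each term evaluated by `gaugeDeriv_m_m`. -/
lemma IsNullAligned.opticalMatrix_skew_cyclic (c : ι) (i j k : Fin (d - 2)) :
    (g.opticalMatrix l x m i j - g.opticalMatrix l x m j i) * phiPrime t A c x n m k
      + (g.opticalMatrix l x m j k - g.opticalMatrix l x m k j) * phiPrime t A c x n m i
      + (g.opticalMatrix l x m k i - g.opticalMatrix l x m i k) * phiPrime t A c x n m j = 0 := by
  have h := bianchi t hA g c x (m i) (m j) (m k)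
  simp only [hnull.gaugeDeriv_m_m hd hA hl hfr] at h
  have h4 : ∀ i k, g.opticalMatrix l x m i k = g.val x (g.nabla x (m k) l) (m i) :=
    fun i k => g.symm x _ _
  simp only [h4]
  linarith

lemma IsNullAligned.exists_opticalMatrix_skew_eq (c : ι) (hc : phiPrime t A c x n m ≠ 0) :
    ∃ w : Fin (d - 2) → ℝ, ∀ i j,
      (g.opticalMatrix l x m i j - g.opticalMatrix l x m j i) / 2
        = (w i * phiPrime t A c x n m j - w j * phiPrime t A c x n m i) / 2 := by
  obtain ⟨k, hk⟩ := Function.ne_iff.1 hc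
  have hk : phiPrime t A c x n m k ≠ 0 := hk
  -- The witness is the cyclic identity solved for its `(i, j)` term by dividing by `φ'_k`.
  refine ⟨fun i => (g.opticalMatrix l x m i k - g.opticalMatrix l x m k i)
    / phiPrime t A c x n m k, fun i j => ?_⟩
  have h := hnull.opticalMatrix_skew_cyclic hd hA hl hfr c i j k
  field_simp
  linarith

end Null

end NullYM

/-! ### Assembly of the main theorem -/

theorem mainTheorem8 {d : ℕ} (hd : 4 ≤ d)
    {M : Type*} [TopologicalSpace M] [ChartedSpace (EuclideanSpace ℝ (Fin d)) M]
    [IsManifold (𝓡 d) ∞ M] (g : LorentzianMetric d M)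
    {𝔤 : Type*} [LieRing 𝔤] [LieAlgebra ℝ 𝔤] {ι : Type*} [Fintype ι] (t : Module.Basis ι ℝ 𝔤)
    (A : ι → Π x : M, TangentSpace (𝓡 d) x →L[ℝ] ℝ) (hA : ∀ a, SmoothOneForm (A a))
    (l : Π x : M, TangentSpace (𝓡 d) x) (hl : SmoothVectorField l)
    (hYM : IsYangMills t g A) (hne : IsNonvanishing t A) (hnull : IsNullAligned t g A l) :
    g.IsGeodetic l ∧
    ∀ (x : M) (n : TangentSpace (𝓡 d) x) (m : Fin (d - 2) → TangentSpace (𝓡 d) x),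
      g.IsNullFrame x (l x) n m →
      (∀ a i, ∑ j, ((g.opticalMatrix l x m i j + g.opticalMatrix l x m j i) / 2) *
            phiPrime t A a x n m j
          = (g.opticalMatrix l x m).trace / 2 * phiPrime t A a x n m i) ∧
      (∃ w : ι → Fin (d - 2) → ℝ, ∀ i j,
        (g.opticalMatrix l x m i j - g.opticalMatrix l x m j i) / 2
          = ∑ a, (w a i * phiPrime t A a x n m j - w a j * phiPrime t A a x n m i) / 2) ∧
      (∃ w : ι → Fin (d - 2) → ℝ, ∀ a, phiPrime t A a x n m ≠ 0 → ∀ i j,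
        (g.opticalMatrix l x m i j - g.opticalMatrix l x m j i) / 2
          = (w a i * phiPrime t A a x n m j - w a j * phiPrime t A a x n m i) / 2) := by
  classical
  have hd2 : 2 ≤ d := by omega
  refine ⟨?_, fun x n m hfr => ⟨fun a i =>
    hnull.opticalMatrix_symm_mulVec hd2 hA hl hfr hYM a i, ?_, ?_⟩⟩
  · have h : ∀ x, ∃ c : ℝ, g.nabla x (l x) l = c • l x := by
      intro x
      obtain ⟨n, m, hfr, -⟩ := hnull x
      exact ⟨_, hnull.nabla_self_eq_smul hd2 hA hl hfr hYM hne⟩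
    choose c hc using h
    exact ⟨c, hc⟩
  · obtain ⟨a, ha⟩ := hnull.exists_phiPrime_ne_zero hd2 hA hfr hne
    obtain ⟨w, hw⟩ := hnull.exists_opticalMatrix_skew_eq hd2 hA hl hfr a ha
    -- One Lie-algebra index with nonzero `φ'` already represents the skew part, so all other
    -- coefficients are set to zero.
    refine ⟨fun b => if b = a then w else 0, fun i j => ?_⟩
    rw [Finset.sum_eq_single a (fun b _ hb => by simp [hb]) (by simp), hw]
    simp
  · choose! w hw using fun a => hnull.exists_opticalMatrix_skew_eq hd2 hA hl hfr a
    exact ⟨w, hw⟩
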